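/- Let $U\subseteq\mathbb R^4$ be a non-empty connected open set with coordinates $(t,x,y,z)$, let $I$ and $J$ be its projections to the $x$-axis and the $z$-axis, and let $H,D$ be smooth real functions on $I$, with $D$ nowhere zero, and $S$ a smooth real function on $J$. Let $U$ carry the Gödel-type Lorentzian metric $$ds^2=[dt+H(x)\,dy]^2-D^2(x)\,dy^2-dx^2-dz^2$$ and a smooth metric-compatible linear connection $\Gamma$ whose torsion $T^a{}_{bc}=\Gamma^a{}_{bc}-\Gamma^a{}_{cb}$ has as its only non-vanishing components $T^t{}_{xy}=-T^t{}_{yx}=D(x)\,S(z)$. This Riemann–Cartan space-time is called locally space-time homogeneous if for any two points $p,q\in U$ there is a diffeomorphism of an open neighbourhood of $p$ in $U$ onto an open neighbourhood of $q$ in $U$ which maps $p$ to $q$ and preserves both the metric and the connection. It is locally space-time homogeneous if and only if the following three conditions hold: there are real constants $\omega$, $m^2$ (which may be of either sign or zero) and $S_0$ such that $$\frac{H'}{D}=2\omega \text{ on } I,\qquad \frac{D''}{D}=m^2 \text{ on } I,\qquad S=S_0 \text{ on } J .$$ -/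

import Mathlib

open scoped ContDiff

/-- The coordinate space `ℝ⁴`; the coordinates `0, 1, 2, 3` are `t, x, y, z`. -/
abbrev Coord : Type := Fin 4 → ℝ

/-- The Minkowski matrix `diag (+1, -1, -1, -1)`. -/
def minkowski : Matrix (Fin 4) (Fin 4) ℝ := Matrix.diagonal ![1, -1, -1, -1]

/-- A smooth Riemann-Cartan structure on an open set `U` of `ℝ⁴`: a Lorentzian metric `g` and a
metric-compatible linear connection, not assumed symmetric, given by its coefficients `Γ`, so that
`∇_u V = dV(u) + Γ(u, V)`, that is `∇_b V^a = ∂_b V^a + Γ^a_{bc} V^c`. -/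
structure RiemannCartan (U : Set Coord) where
  /-- the metric tensor -/
  g : Coord → Coord →L[ℝ] Coord →L[ℝ] ℝ
  /-- the connection coefficients -/
  Γ : Coord → Coord →L[ℝ] Coord →L[ℝ] Coord
  g_smooth : ContDiffOn ℝ ∞ g U
  Γ_smooth : ContDiffOn ℝ ∞ Γ U
  g_symm : ∀ p ∈ U, ∀ u v, g p u v = g p v u
  g_lorentzian : ∀ p ∈ U, ∃ e : Module.Basis (Fin 4) ℝ Coord,
    ∀ i j, g p (e i) (e j) = minkowski i j
  /-- `∇ g = 0` -/
  g_parallel : ∀ p ∈ U, ∀ u v w,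
    fderiv ℝ g p u v w = g p (Γ p u v) w + g p v (Γ p u w)

namespace RiemannCartan

variable {U : Set Coord}

/-- The torsion tensor `T^a_{bc} = Γ^a_{bc} - Γ^a_{cb}`. -/
noncomputable def torsion (M : RiemannCartan U) (p u v : Coord) : Coord := M.Γ p u v - M.Γ p v u

/-- `φ` is a local affine isometry of `M`: a smooth diffeomorphism between open subsets of `U`
which preserves the metric and the connection. -/
structure IsLocalAffineIsometry (M : RiemannCartan U) (φ : OpenPartialHomeomorph Coord Coord) :
    Prop where
  source_subset : φ.source ⊆ U
  target_subset : φ.target ⊆ U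
  smooth : ContDiffOn ℝ ∞ φ φ.source
  smooth_symm : ContDiffOn ℝ ∞ φ.symm φ.target
  isometry : ∀ p ∈ φ.source, ∀ u v,
    M.g (φ p) (fderiv ℝ φ p u) (fderiv ℝ φ p v) = M.g p u v
  /-- the transformation law of the connection coefficients -/
  affine : ∀ p ∈ φ.source, ∀ u v,
    fderiv ℝ φ p (M.Γ p u v) =
      fderiv ℝ (fderiv ℝ φ) p u v + M.Γ (φ p) (fderiv ℝ φ p u) (fderiv ℝ φ p v)

/-- Local homogeneity: any point can be carried to any other one by an affine isometry between
neighbourhoods of the two points. -/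
def LocallyHomogeneous (M : RiemannCartan U) : Prop :=
  ∀ p ∈ U, ∀ q ∈ U, ∃ φ : OpenPartialHomeomorph Coord Coord,
    M.IsLocalAffineIsometry φ ∧ p ∈ φ.source ∧ φ p = q

/-- The metric is `ds² = [dt + H(x) dy]² - D(x)² dy² - dx² - dz²`. -/
def HasGodelMetric (M : RiemannCartan U) (H D : ℝ → ℝ) : Prop :=
  ∀ p ∈ U, ∀ v : Coord,
    M.g p v v = (v 0 + H (p 1) * v 2) ^ 2 - D (p 1) ^ 2 * v 2 ^ 2 - v 1 ^ 2 - v 3 ^ 2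

/-- The only nonvanishing torsion component is `T^t_{xy} = -T^t_{yx} = D(x) S(z)`. -/
def HasPolarizedTorsion (M : RiemannCartan U) (D S : ℝ → ℝ) : Prop :=
  ∀ p ∈ U, ∀ u v : Coord,
    M.torsion p u v = Pi.single 0 (D (p 1) * S (p 3) * (u 1 * v 2 - u 2 * v 1))

end RiemannCartan

open Filter Topology

/-! A metric connection is determined by its torsion, because the difference of two candidates is
symmetric in one pair of slots and skew in another (`eq_zero_of_symm_of_skew`). Both directions rest
on the coframe e⁰ = dt + H dy, e¹ = dx, e² = D dy, e³ = dz, in which the metric is Minkowski's and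
the torsion is S e₀ ⊗ (e¹ ∧ e²).

Necessity: in these coframes the differential of a local affine isometry is a Lorentz map that
intertwines torsion and curvature at the two points. The torsion gives S²
(`sq_le_sq_of_lorentz_torsion`), and continuity on a connected set makes S constant. With w = H'/D -
S, the curvature then depends only on w, w', S and D''/D, and the characteristic polynomial of its
Ricci tensor is an invariant (`det_ricciPencil_eq`). One of its roots is constant by continuity,
since finitely many values are available. The remaining factor fixes w², hence w, and the constant
root then fixes D''/D.

Sufficiency: if D'' = m² D, the surface dx² + D² dy² has constant curvature -m², so it embeds
locally in the quadric f₀² = 1 + m²(f₁² + f₂²) with any chosen point at the pole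
(`exists_hyperboloid_coords`). If H' = 2ωD, then H dy differs by an exact form from a
rotation-invariant potential of the area form, and the difference is absorbed in t
(`exists_isModelChart`). Thus every point is the origin of a chart to one fixed model. A transition
between two such charts preserves the metric, the area form and ∂ₜ, hence the torsion, hence the
connection. -/

/-- A trilinear expression symmetric in its first two arguments and skew in its last two vanishes. -/
lemma eq_zero_of_symm_of_skew {E : Type*} (B : E → E → E → ℝ) (h₁ : ∀ u v w, B u v w = B v u w)
    (h₂ : ∀ u v w, B u v w = -B u w v) (u v w : E) : B u v w = 0 := by
  linarith [h₁ u v w, h₂ v u w, h₁ v w u, h₂ w v u, h₁ w u v, h₂ u w v]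

/-! ### Curvature under gauge change and pullback -/

section Gauge

variable {E F : Type*} [NormedAddCommGroup E] [NormedSpace ℝ E]
  [NormedAddCommGroup F] [NormedSpace ℝ F]

/-- The curvature of the connection `d + A` on the trivial bundle with fibre `F`. -/
noncomputable def connCurvature (A : E → E →L[ℝ] F →L[ℝ] F) (p u v : E) (c : F) : F :=
  fderiv ℝ A p u v c - fderiv ℝ A p v u c + A p u (A p v c) - A p v (A p u c)

/-- Curvature is equivariant under gauge transformations. -/
lemma connCurvature_gauge {G : Type*} [NormedAddCommGroup G] [NormedSpace ℝ G]
    {A : E → E →L[ℝ] G →L[ℝ] G} {B : E → E →L[ℝ] F →L[ℝ] F}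
    {θ : E → G →L[ℝ] F} {p : E} (hA : DifferentiableAt ℝ A p) (hB : DifferentiableAt ℝ B p)
    (hθ : ContDiffAt ℝ 2 θ p)
    (h : ∀ᶠ x in 𝓝 p, ∀ u v, θ x (A x u v) = fderiv ℝ θ x u v + B x u (θ x v)) (u v : E) (c : G) :
    θ p (connCurvature A p u v c) = connCurvature B p u v (θ p c) := by
  have hθ₁ : DifferentiableAt ℝ θ p := hθ.differentiableAt (by norm_num)
  have hθ₂ : DifferentiableAt ℝ (fderiv ℝ θ) p :=
    (hθ.fderiv_right (m := 1) (by norm_num)).differentiableAt (by norm_num)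
  -- The gauge relation is differentiated once. Skew-symmetrising in `a` and `b` then cancels the
  -- second derivative of `θ`.
  have key : ∀ a b : E, fderiv ℝ θ p a (A p b c) + θ p (fderiv ℝ A p a b c) =
      fderiv ℝ (fderiv ℝ θ) p a b c + (fderiv ℝ B p a b (θ p c) + B p b (fderiv ℝ θ p a c)) := by
    intro a b
    have e₁ : HasFDerivAt (fun x => θ x (A x b c)) _ p := hθ₁.hasFDerivAt.clm_apply
      ((hA.hasFDerivAt.clm_apply (hasFDerivAt_const b p)).clm_apply (hasFDerivAt_const c p))
    have e₂ : HasFDerivAt (fun x => fderiv ℝ θ x b c + B x b (θ x c)) _ p :=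
      ((hθ₂.hasFDerivAt.clm_apply (hasFDerivAt_const b p)).clm_apply (hasFDerivAt_const c p)).add
      ((hB.hasFDerivAt.clm_apply (hasFDerivAt_const b p)).clm_apply
        (hθ₁.hasFDerivAt.clm_apply (hasFDerivAt_const c p)))
    have e₃ := (e₁.congr_of_eventuallyEq (h.mono fun x hx => (hx b c).symm)).unique e₂
    have e₄ := DFunLike.congr_fun e₃ a
    simp at e₄
    rw [add_comm, e₄]
    abel
  have hs : fderiv ℝ (fderiv ℝ θ) p u v = fderiv ℝ (fderiv ℝ θ) p v u :=
    hθ.isSymmSndFDerivAt (by simp) u v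
  have hp := h.self_of_nhds
  have k₁ := key u v
  have k₂ := key v u
  rw [hs] at k₁
  simp only [connCurvature, map_sub, map_add, hp]
  have k₃ := eq_sub_of_add_eq' k₁
  have k₄ := eq_sub_of_add_eq' k₂
  rw [k₃, k₄]
  abel

/-- The curvature of a pulled back connection is the pulled back curvature. -/
lemma connCurvature_pullback {E' : Type*} [NormedAddCommGroup E'] [NormedSpace ℝ E']
    {A : E' → E' →L[ℝ] F →L[ℝ] F} {φ : E → E'} {p : E}
    (hA : DifferentiableAt ℝ A (φ p)) (hφ : ContDiffAt ℝ 2 φ p) (u v : E) (c : F) :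
    connCurvature (fun x => (A (φ x)).comp (fderiv ℝ φ x)) p u v c =
      connCurvature A (φ p) (fderiv ℝ φ p u) (fderiv ℝ φ p v) c := by
  have hφ₁ : DifferentiableAt ℝ φ p := hφ.differentiableAt (by norm_num)
  have hφ₂ : DifferentiableAt ℝ (fderiv ℝ φ) p :=
    (hφ.fderiv_right (m := 1) (by norm_num)).differentiableAt (by norm_num)
  have e : HasFDerivAt (fun x => (A (φ x)).comp (fderiv ℝ φ x)) _ p :=
    (hA.hasFDerivAt.comp p hφ₁.hasFDerivAt).clm_comp hφ₂.hasFDerivAt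
  have hs : fderiv ℝ (fderiv ℝ φ) p u v = fderiv ℝ (fderiv ℝ φ) p v u :=
    hφ.isSymmSndFDerivAt (by simp) u v
  simp only [connCurvature, e.fderiv]
  simp [hs]

end Gauge

/-! ### Metric connections are determined by their torsion -/

namespace RiemannCartan

variable {U : Set Coord}

lemma g_nondegenerate (M : RiemannCartan U) {p : Coord} (hp : p ∈ U) {u : Coord}
    (h : ∀ v, M.g p u v = 0) : u = 0 := by
  obtain ⟨e, he⟩ := M.g_lorentzian p hp
  have hu := e.sum_repr u
  have hc : ∀ j, e.repr u j = 0 := by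
    intro j
    have h1 := h (e j)
    rw [← hu] at h1
    simp only [map_sum, map_smul, FunLike.coe_sum, Finset.sum_apply, FunLike.coe_smul, Pi.smul_apply, he, minkowski, Matrix.diagonal_apply] at h1
    fin_cases j <;> simpa using h1
  rw [← hu]
  simp [hc]

/-- Two metric connections with the same torsion agree. -/
lemma Γ_unique (M : RiemannCartan U) {p : Coord} (hp : p ∈ U) (Γ' : Coord → Coord → Coord)
    (h₁ : ∀ u v w, fderiv ℝ M.g p u v w = M.g p (Γ' u v) w + M.g p v (Γ' u w))
    (h₂ : ∀ u v, Γ' u v - Γ' v u = M.torsion p u v) (u v : Coord) : M.Γ p u v = Γ' u v := by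
  rw [← sub_eq_zero]
  refine M.g_nondegenerate hp fun w => ?_
  -- Equal torsions make the difference symmetric in `u`, `v`. Compatibility with the metric makes
  -- it skew in `v`, `w`.
  refine eq_zero_of_symm_of_skew (fun u v w => M.g p (M.Γ p u v - Γ' u v) w) ?_ ?_ u v w
  · intro u v w
    have := h₂ u v
    simp only [torsion] at this
    have : M.Γ p u v - Γ' u v = M.Γ p v u - Γ' v u := by
      rw [sub_eq_sub_iff_sub_eq_sub, this]
    simp only [this]
  · intro u v w
    have a := h₁ u v w
    rw [M.g_parallel p hp u v w] at a
    simp only [map_sub, FunLike.coe_sub, Pi.sub_apply]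
    rw [M.g_symm p hp (M.Γ p u w) v, M.g_symm p hp (Γ' u w) v]
    linarith

end RiemannCartan

/-! ### The Gödel coframe, its connection form and its curvature -/

/-- The Minkowski inner product of signature `(+,-,-,-)`. -/
def lorentzInner (a b : Coord) : ℝ := a 0 * b 0 - a 1 * b 1 - a 2 * b 2 - a 3 * b 3

/-- The constant one-form `c dxᵢ` with values in a normed space. -/
noncomputable def coordSMul {F : Type*} [NormedAddCommGroup F] [NormedSpace ℝ F] (i : Fin 4)
    (c : F) : Coord →L[ℝ] F :=
  (ContinuousLinearMap.proj i : Coord →L[ℝ] ℝ).smulRight c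

@[simp]
lemma coordSMul_apply {F : Type*} [NormedAddCommGroup F] [NormedSpace ℝ F] (i : Fin 4)
    (c : F) (u : Coord) : coordSMul i c u = u i • c := rfl

/-- The coframe `dt + H dy, dx, D dy, dz`. -/
noncomputable def godelCoframe (H D : ℝ → ℝ) (p : Coord) : Coord →L[ℝ] Coord :=
  ContinuousLinearMap.id ℝ Coord -
      coordSMul 2 (Pi.single 2 1 : Coord)
    + H (p 1) • coordSMul 2 (Pi.single 0 1 : Coord)
    + D (p 1) • coordSMul 2 (Pi.single 2 1 : Coord)

lemma godelCoframe_apply (H D : ℝ → ℝ) (p u : Coord) :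
    godelCoframe H D p u = ![u 0 + H (p 1) * u 2, u 1, D (p 1) * u 2, u 3] := by
  ext i
  fin_cases i <;> simp [godelCoframe, mul_comm]

/-- The inverse of the coframe `dt + H dy, dx, D dy, dz` at a point where `H = h` and `D = d`. -/
noncomputable def coframeInv (h d : ℝ) (a : Coord) : Coord :=
  ![a 0 - h * (a 2 / d), a 1, a 2 / d, a 3]

lemma godelCoframe_coframeInv {H D : ℝ → ℝ} {p : Coord} (hD : D (p 1) ≠ 0) (a : Coord) :
    godelCoframe H D p (coframeInv (H (p 1)) (D (p 1)) a) = a := by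
  ext i
  fin_cases i <;> simp [godelCoframe_apply, coframeInv]
  field_simp

lemma coframeInv_godelCoframe {H D : ℝ → ℝ} {p : Coord} (hD : D (p 1) ≠ 0) (u : Coord) :
    coframeInv (H (p 1)) (D (p 1)) (godelCoframe H D p u) = u := by
  ext i
  fin_cases i <;> simp [godelCoframe_apply, coframeInv] <;> field_simp
  ring

lemma hasFDerivAt_comp_coord {F : Type*} [NormedAddCommGroup F] [NormedSpace ℝ F] {f : ℝ → F}
    {f' : F} {p : Coord} (i : Fin 4) (hf : HasDerivAt f f' (p i)) :
    HasFDerivAt (fun q : Coord => f (q i))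
      (coordSMul i f') p := by
  refine (hf.hasFDerivAt.comp p
    (ContinuousLinearMap.proj i : Coord →L[ℝ] ℝ).hasFDerivAt).congr_fderiv ?_
  ext v
  simp

lemma hasFDerivAt_godelCoframe {H D : ℝ → ℝ} {p : Coord} {H' D' : ℝ}
    (hH : HasDerivAt H H' (p 1)) (hD : HasDerivAt D D' (p 1)) :
    HasFDerivAt (godelCoframe H D)
      (coordSMul 1
        (H' • coordSMul 2 (Pi.single 0 1 : Coord)
        + D' • coordSMul 2 (Pi.single 2 1 : Coord))) p := by
  have := hasFDerivAt_comp_coord 1 (((hH.smul_const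
    (coordSMul 2 (Pi.single 0 1 : Coord))).add
    (hD.smul_const
    (coordSMul 2 (Pi.single 2 1 : Coord)))).const_add
    (ContinuousLinearMap.id ℝ Coord -
      coordSMul 2 (Pi.single 2 1 : Coord)))
  refine this.congr_of_eventuallyEq (Eventually.of_forall fun x => ?_)
  simp [godelCoframe, add_assoc]

/-- The elementary matrices spanning the Lorentz algebra of the first three coordinates:
the boosts for `(i, j, s) = (0, 1, 1), (0, 2, 1)` and the rotation for `(1, 2, -1)`. -/
noncomputable def lorentzGen (i j : Fin 4) (s : ℝ) : Coord →L[ℝ] Coord :=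
  coordSMul j (Pi.single i 1 : Coord) +
  s • coordSMul i (Pi.single j 1 : Coord)

/-- The metric connection form in the Gödel coframe whose torsion is `H' / D - w`. -/
noncomputable def godelConn (H D w : ℝ → ℝ) (p : Coord) : Coord →L[ℝ] Coord →L[ℝ] Coord :=
  (w (p 1) / 2 * D (p 1)) •
      coordSMul 2 (lorentzGen 0 1 1)
  + (w (p 1) / 2) •
      (coordSMul 0 (lorentzGen 1 2 (-1))
        - coordSMul 1 (lorentzGen 0 2 1))
  + (w (p 1) / 2 * H (p 1) - deriv D (p 1)) •
      coordSMul 2 (lorentzGen 1 2 (-1))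

lemma godelConn_apply (H D w : ℝ → ℝ) (p u a : Coord) :
    godelConn H D w p u a =
      ![w (p 1) / 2 * D (p 1) * u 2 * a 1 - w (p 1) / 2 * u 1 * a 2,
        w (p 1) / 2 * D (p 1) * u 2 * a 0 +
          (w (p 1) / 2 * (u 0 + H (p 1) * u 2) - deriv D (p 1) * u 2) * a 2,
        -(w (p 1) / 2) * u 1 * a 0 -
          (w (p 1) / 2 * (u 0 + H (p 1) * u 2) - deriv D (p 1) * u 2) * a 1,
        0] := by
  ext i
  fin_cases i <;> simp [godelConn, lorentzGen] <;> ring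

lemma hasFDerivAt_godelConn {H D w : ℝ → ℝ} {p : Coord} {H' D' D'' w' : ℝ}
    (hH : HasDerivAt H H' (p 1)) (hD : HasDerivAt D D' (p 1))
    (hD' : HasDerivAt (deriv D) D'' (p 1)) (hw : HasDerivAt w w' (p 1)) :
    HasFDerivAt (godelConn H D w)
      (coordSMul 1
        ((w' / 2 * D (p 1) + w (p 1) / 2 * D') •
            coordSMul 2 (lorentzGen 0 1 1)
        + (w' / 2) •
            (coordSMul 0 (lorentzGen 1 2 (-1))
              - coordSMul 1 (lorentzGen 0 2 1))
        + (w' / 2 * H (p 1) + w (p 1) / 2 * H' - D'') •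
            coordSMul 2 (lorentzGen 1 2 (-1)))) p := by
  have h₁ : HasDerivAt (fun x => w x / 2 * D x) _ (p 1) := (hw.div_const 2).mul hD
  have h₂ : HasDerivAt (fun x => w x / 2) _ (p 1) := hw.div_const 2
  have h₃ : HasDerivAt (fun x => w x / 2 * H x - deriv D x) _ (p 1) :=
    ((hw.div_const 2).mul hH).sub hD'
  have e := ((h₁.smul_const (coordSMul 2
      (lorentzGen 0 1 1))).fun_add
    (h₂.smul_const (coordSMul 0 (lorentzGen 1 2 (-1))
      - coordSMul 1 (lorentzGen 0 2 1)))).fun_add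
    (h₃.smul_const (coordSMul 2
      (lorentzGen 1 2 (-1))))
  exact hasFDerivAt_comp_coord 1 e

/-- The curvature of a Gödel type connection in the Gödel coframe. -/
noncomputable def frameCurvature (α β κ : ℝ) (a b c : Coord) : Coord :=
  ![(β * (a 1 * b 2 - a 2 * b 1) + α * (a 1 * b 0 - a 0 * b 1)) * c 1
      + α * (a 2 * b 0 - a 0 * b 2) * c 2,
    (β * (a 1 * b 2 - a 2 * b 1) + α * (a 1 * b 0 - a 0 * b 1)) * c 0
      + (β * (a 1 * b 0 - a 0 * b 1) + κ * (a 1 * b 2 - a 2 * b 1)) * c 2,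
    α * (a 2 * b 0 - a 0 * b 2) * c 0
      - (β * (a 1 * b 0 - a 0 * b 1) + κ * (a 1 * b 2 - a 2 * b 1)) * c 1,
    0]

/-- This is the second structure equation. The torsion `s` enters through H' = (w + s) D. Once `u`
and `v` are expressed in the coframe, H and D' drop out, and only w, w', s and K = D''/D remain. -/
lemma connCurvature_godelConn {H D w : ℝ → ℝ} {p : Coord} {s K w' D' : ℝ}
    (hH : HasDerivAt H ((w (p 1) + s) * D (p 1)) (p 1)) (hD : HasDerivAt D D' (p 1))
    (hD' : HasDerivAt (deriv D) (K * D (p 1)) (p 1)) (hw : HasDerivAt w w' (p 1)) (u v c : Coord) :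
    connCurvature (godelConn H D w) p u v c =
      frameCurvature (w (p 1) ^ 2 / 4) (w' / 2) (3 * w (p 1) ^ 2 / 4 + w (p 1) * s / 2 - K)
        (godelCoframe H D p u) (godelCoframe H D p v) c := by
  rw [connCurvature, (hasFDerivAt_godelConn hH hD hD' hw).fderiv]
  simp only [godelConn_apply, godelCoframe_apply, frameCurvature, hD.deriv]
  generalize H (p 1) = h
  generalize D (p 1) = d
  generalize w (p 1) = W
  ext i
  simp only [Pi.add_apply, Pi.sub_apply]
  fin_cases i <;> simp [lorentzGen] <;> ring

namespace RiemannCartan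

variable {U : Set Coord} {M : RiemannCartan U} {H D S : ℝ → ℝ}

lemma HasGodelMetric.g_apply (hg : M.HasGodelMetric H D) {p : Coord} (hp : p ∈ U) (u v : Coord) :
    M.g p u v = lorentzInner (godelCoframe H D p u) (godelCoframe H D p v) := by
  have h₁ := hg p hp (u + v)
  have h₂ := hg p hp u
  have h₃ := hg p hp v
  have h₄ := M.g_symm p hp u v
  simp only [map_add, FunLike.coe_add, Pi.add_apply] at h₁
  simp [lorentzInner, godelCoframe_apply]
  linarith

lemma HasGodelMetric.fderiv_g (hU : IsOpen U) (hg : M.HasGodelMetric H D) {p : Coord} (hp : p ∈ U)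
    (hH : DifferentiableAt ℝ H (p 1)) (hD : DifferentiableAt ℝ D (p 1)) (u v w : Coord) :
    fderiv ℝ M.g p u v w =
      lorentzInner (fderiv ℝ (godelCoframe H D) p u v) (godelCoframe H D p w) +
      lorentzInner (godelCoframe H D p v) (fderiv ℝ (godelCoframe H D) p u w) := by
  have hU' := hU.mem_nhds hp
  have hgd : DifferentiableAt ℝ M.g p :=
    (M.g_smooth.contDiffAt hU').differentiableAt (by simp)
  have e₁ := (hgd.hasFDerivAt.clm_apply (hasFDerivAt_const v p)).clm_apply (hasFDerivAt_const w p)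
  have hθ := hasFDerivAt_godelCoframe hH.hasDerivAt hD.hasDerivAt
  have hc : ∀ v i, HasFDerivAt (fun q => godelCoframe H D q v i) _ p := fun v i =>
    (ContinuousLinearMap.proj i : Coord →L[ℝ] ℝ).hasFDerivAt.comp p
      (hθ.clm_apply (hasFDerivAt_const v p))
  have e₂ := ((((hc v 0).mul (hc w 0)).sub ((hc v 1).mul (hc w 1))).sub
    ((hc v 2).mul (hc w 2))).sub ((hc v 3).mul (hc w 3))
  have e₃ := e₁.unique (e₂.congr_of_eventuallyEq
    (eventually_of_mem hU' fun x hx => hg.g_apply hx v w))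
  have e₄ := DFunLike.congr_fun e₃ u
  rw [hθ.fderiv]
  simp at e₄
  rw [e₄]
  simp [lorentzInner, godelCoframe_apply]
  ring

/-- The structure equation expressing the connection by its form in the Gödel coframe. -/
lemma HasGodelMetric.godelCoframe_Γ (hU : IsOpen U) (hg : M.HasGodelMetric H D)
    (hT : M.HasPolarizedTorsion D S) {p : Coord} (hp : p ∈ U)
    (hH : DifferentiableAt ℝ H (p 1)) (hD : DifferentiableAt ℝ D (p 1)) (hD0 : D (p 1) ≠ 0)
    (u v : Coord) :
    godelCoframe H D p (M.Γ p u v) = fderiv ℝ (godelCoframe H D) p u v +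
      godelConn H D (fun x => deriv H x / D x - S (p 3)) p u (godelCoframe H D p v) := by
  have hθ := hasFDerivAt_godelCoframe hH.hasDerivAt hD.hasDerivAt
  rw [M.Γ_unique hp (fun u v => coframeInv (H (p 1)) (D (p 1)) (fderiv ℝ (godelCoframe H D) p u v +
      godelConn H D (fun x => deriv H x / D x - S (p 3)) p u (godelCoframe H D p v))) ?_ ?_ u v, godelCoframe_coframeInv hD0]
  · intro u v w
    rw [hg.fderiv_g hU hp hH hD, hg.g_apply hp, hg.g_apply hp, godelCoframe_coframeInv hD0,
      godelCoframe_coframeInv hD0, hθ.fderiv]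
    simp [lorentzInner, godelCoframe_apply, godelConn_apply]
    ring
  · intro u v
    rw [hT p hp, hθ.fderiv]
    ext i
    fin_cases i <;> simp [coframeInv, godelCoframe_apply, godelConn_apply] <;> field_simp <;> ring

end RiemannCartan

/-! ### Lorentz invariants of the torsion and of the Ricci tensor -/

lemma injective_of_lorentzInner {L : Coord →ₗ[ℝ] Coord}
    (hL : ∀ a b, lorentzInner (L a) (L b) = lorentzInner a b) : Function.Injective L := by
  rw [injective_iff_map_eq_zero]
  intro a ha
  have h : ∀ b, lorentzInner a b = 0 := fun b => by rw [← hL, ha]; simp [lorentzInner]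
  ext i
  have := h (Pi.single i 1)
  fin_cases i <;> simpa [lorentzInner] using this

/-- The torsion `s e₀ ⊗ (e¹ ∧ e²)` determines `s ^ 2` up to Lorentz transformations. -/
lemma sq_le_sq_of_lorentz_torsion {L : Coord →ₗ[ℝ] Coord}
    (hL : ∀ a b, lorentzInner (L a) (L b) = lorentzInner a b) {s s' : ℝ}
    (h : ∀ a b, L (Pi.single 0 (s * (a 1 * b 2 - a 2 * b 1))) =
      Pi.single 0 (s' * (L a 1 * L b 2 - L a 2 * L b 1))) : s ^ 2 ≤ s' ^ 2 := by
  rcases eq_or_ne s 0 with rfl | hs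
  · nlinarith [sq_nonneg s']
  have h₁₂ := h (Pi.single 1 1) (Pi.single 2 1)
  have h₀ : L (Pi.single 0 s) = s • L (Pi.single 0 1) := by
    rw [← map_smul, ← Pi.single_smul, smul_eq_mul, mul_one]
  simp [h₀] at h₁₂
  have i₀₀ := hL (Pi.single 0 1) (Pi.single 0 1)
  have i₀₁ := hL (Pi.single 0 1) (Pi.single 1 1)
  have i₀₂ := hL (Pi.single 0 1) (Pi.single 2 1)
  have i₁₁ := hL (Pi.single 1 1) (Pi.single 1 1)
  have i₁₂ := hL (Pi.single 1 1) (Pi.single 2 1)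
  have i₂₂ := hL (Pi.single 2 1) (Pi.single 2 1)
  set r := L (Pi.single 0 1)
  set p := L (Pi.single 1 1)
  set q := L (Pi.single 2 1)
  simp [lorentzInner] at i₀₀ i₀₁ i₀₂ i₁₁ i₁₂ i₂₂
  have c₀ := congr_fun h₁₂ 0
  have c₁ := congr_fun h₁₂ 1
  have c₂ := congr_fun h₁₂ 2
  have c₃ := congr_fun h₁₂ 3
  simp [hs] at c₀ c₁ c₂ c₃
  simp only [c₁, c₂, c₃] at i₀₀ i₀₁ i₀₂
  -- The image `r` of e₀ is a multiple of e₀, so the images `p` and `q` of e₁ and e₂, being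
  -- orthogonal to it, are purely spatial.
  have hr : r 0 ≠ 0 := by
    intro h
    simp [h] at i₀₀
  have p₀ : p 0 = 0 := by simpa [hr] using i₀₁
  have q₀ : q 0 = 0 := by simpa [hr] using i₀₂
  simp only [p₀, q₀] at i₁₁ i₁₂ i₂₂
  -- This is one component of the cross product of two orthonormal spatial vectors, which is a unit
  -- vector by Lagrange's identity.
  have hm : (p 1 * q 2 - p 2 * q 1) ^ 2 ≤ 1 := by
    have : (p 1 * q 2 - p 2 * q 1) ^ 2 = 1 - (p 2 * q 3 - p 3 * q 2) ^ 2
        - (p 3 * q 1 - p 1 * q 3) ^ 2 := by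
      linear_combination (-(q 1 ^ 2 + q 2 ^ 2 + q 3 ^ 2)) * i₁₁ - i₂₂
        + (p 1 * q 1 + p 2 * q 2 + p 3 * q 3) * i₁₂
    nlinarith [sq_nonneg (p 2 * q 3 - p 3 * q 2), sq_nonneg (p 3 * q 1 - p 1 * q 3)]
  have : s ^ 2 = s' ^ 2 * (p 1 * q 2 - p 2 * q 1) ^ 2 := by
    rw [← mul_pow, ← c₀]
    linear_combination (-s ^ 2) * i₀₀
  rw [this]
  nlinarith [sq_nonneg s']

/-- The endomorphism whose trace is the Ricci curvature. -/
noncomputable def frameCurvatureLinear (α β κ : ℝ) (b c : Coord) : Coord →ₗ[ℝ] Coord where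
  toFun a := frameCurvature α β κ a b c
  map_add' x y := by
    ext i
    fin_cases i <;> simp [frameCurvature] <;> ring
  map_smul' r x := by
    ext i
    fin_cases i <;> simp [frameCurvature] <;> ring

/-- The matrix `Ric - l η` in the Gödel coframe. -/
noncomputable def ricciPencil (α β κ l : ℝ) : Matrix (Fin 4) (Fin 4) ℝ :=
  !![2 * α - l, 0, β, 0; 0, κ - α + l, 0, 0; β, 0, κ - α + l, 0; 0, 0, 0, l]

lemma dotProduct_ricciPencil (α β κ l : ℝ) (b c : Coord) :
    b ⬝ᵥ (ricciPencil α β κ l).mulVec c =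
      LinearMap.trace ℝ Coord (frameCurvatureLinear α β κ b c) - l * lorentzInner b c := by
  rw [LinearMap.trace_eq_matrix_trace ℝ (Pi.basisFun ℝ (Fin 4))]
  simp [Matrix.trace, Fin.sum_univ_four, frameCurvatureLinear,
    frameCurvature, ricciPencil, dotProduct, Matrix.mulVec, lorentzInner]
  ring

/-- The directions e₁ and e₃ decouple from the block of e₀ and e₂. What matters later is that α - κ
is a root whatever the value of β. -/
lemma det_ricciPencil (α β κ l : ℝ) : (ricciPencil α β κ l).det =
    l * (l - (α - κ)) * ((2 * α - l) * (l - (α - κ)) - β ^ 2) := by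
  simp [ricciPencil, Matrix.det_succ_row_zero, Fin.sum_univ_succ, Fin.succAbove]
  ring

lemma Matrix.eq_transpose_mul_mul {n : Type*} [Fintype n] [DecidableEq n] {M N A : Matrix n n ℝ}
    (h : ∀ u v : n → ℝ, (A.mulVec u) ⬝ᵥ N.mulVec (A.mulVec v) = u ⬝ᵥ M.mulVec v) :
    M = A.transpose * N * A := by
  ext i j
  have := h (Pi.single i 1) (Pi.single j 1)
  simp only [Matrix.mulVec_single_one, single_one_dotProduct] at this
  rw [Matrix.col_apply] at this
  rw [← this, Matrix.mul_assoc]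
  rfl

/-- The characteristic polynomial of the Ricci tensor is a Lorentz invariant of the curvature. -/
lemma det_ricciPencil_eq {L : Coord →ₗ[ℝ] Coord}
    (hL : ∀ a b, lorentzInner (L a) (L b) = lorentzInner a b) {α β κ α' β' κ' : ℝ}
    (h : ∀ a b c, L (frameCurvature α β κ a b c) = frameCurvature α' β' κ' (L a) (L b) (L c))
    (l : ℝ) : (ricciPencil α β κ l).det = (ricciPencil α' β' κ' l).det := by
  let e : Coord ≃ₗ[ℝ] Coord := LinearEquiv.ofInjectiveEndo L (injective_of_lorentzInner hL)
  have he : ∀ a, e a = L a := fun a => rfl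
  -- The curvature endomorphism at (`L b`, `L c`) is the conjugate by `L` of the one at (`b`, `c`).
  have htr : ∀ b c, LinearMap.trace ℝ Coord (frameCurvatureLinear α' β' κ' (L b) (L c)) =
      LinearMap.trace ℝ Coord (frameCurvatureLinear α β κ b c) := by
    intro b c
    rw [← LinearMap.trace_conj' (frameCurvatureLinear α β κ b c) e]
    congr 1
    refine LinearMap.ext fun x => ?_
    change frameCurvature α' β' κ' x (L b) (L c) = L (frameCurvature α β κ (e.symm x) b c)
    rw [h, ← he (e.symm x), e.apply_symm_apply]
  have hA : ∀ v, (LinearMap.toMatrix' L).mulVec v = L v := fun v => LinearMap.toMatrix'_mulVec L v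
  have hM : ∀ (α₁ β₁ κ₁ α₂ β₂ κ₂ l : ℝ),
      (∀ b c, LinearMap.trace ℝ Coord (frameCurvatureLinear α₂ β₂ κ₂ (L b) (L c)) =
        LinearMap.trace ℝ Coord (frameCurvatureLinear α₁ β₁ κ₁ b c)) →
      ricciPencil α₁ β₁ κ₁ l = (LinearMap.toMatrix' L).transpose * ricciPencil α₂ β₂ κ₂ l *
        LinearMap.toMatrix' L := by
    intro α₁ β₁ κ₁ α₂ β₂ κ₂ l ht
    refine Matrix.eq_transpose_mul_mul fun u v => ?_
    rw [hA, hA, dotProduct_ricciPencil, dotProduct_ricciPencil, hL, ht]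
  -- At zero curvature and l = 1 the pencil is minus the Minkowski matrix, so the congruence says
  -- that det² = 1.
  have hdet : (LinearMap.toMatrix' L).det * (LinearMap.toMatrix' L).det = 1 := by
    have hz : ∀ b c, LinearMap.trace ℝ Coord (frameCurvatureLinear 0 0 0 b c) = 0 := by
      intro b c
      have : frameCurvatureLinear 0 0 0 b c = 0 := by
        ext1 a
        ext i
        fin_cases i <;> simp [frameCurvatureLinear, frameCurvature]
      simp [this]
    have := congr_arg Matrix.det (hM 0 0 0 0 0 0 1 fun b c => by rw [hz, hz])
    rw [Matrix.det_mul, Matrix.det_mul, Matrix.det_transpose, det_ricciPencil] at this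
    linarith
  rw [hM _ _ _ _ _ _ l htr, Matrix.det_mul, Matrix.det_mul, Matrix.det_transpose]
  linear_combination (ricciPencil α' β' κ' l).det * hdet

/-- A continuous function with finitely many values on a preconnected set is constant. -/
lemma IsPreconnected.eq_of_finite_image {X : Type*} [TopologicalSpace X] {s : Set X}
    (hs : IsPreconnected s) {f : X → ℝ} (hf : ContinuousOn f s) {t : Set ℝ} (ht : t.Finite)
    (hft : Set.MapsTo f s t) {x y : X} (hx : x ∈ s) (hy : y ∈ s) : f x = f y :=
  hs.constant_of_mapsTo ht.isDiscrete hf hft hx hy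

/-! ### Local homogeneity forces constant parameters -/

namespace RiemannCartan

variable {U : Set Coord} {M : RiemannCartan U} {H D S : ℝ → ℝ}

lemma IsLocalAffineIsometry.contDiffAt {φ : OpenPartialHomeomorph Coord Coord}
    (h : M.IsLocalAffineIsometry φ) {p : Coord} (hp : p ∈ φ.source) : ContDiffAt ℝ ∞ φ p :=
  h.smooth.contDiffAt (φ.open_source.mem_nhds hp)

lemma IsLocalAffineIsometry.torsion {φ : OpenPartialHomeomorph Coord Coord}
    (h : M.IsLocalAffineIsometry φ) {p : Coord} (hp : p ∈ φ.source) (u v : Coord) :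
    fderiv ℝ φ p (M.torsion p u v) = M.torsion (φ p) (fderiv ℝ φ p u) (fderiv ℝ φ p v) := by
  have hs : fderiv ℝ (fderiv ℝ φ) p u v = fderiv ℝ (fderiv ℝ φ) p v u :=
    (h.contDiffAt hp).isSymmSndFDerivAt (by simp; exact ENat.LEInfty.out) u v
  simp only [RiemannCartan.torsion, map_sub, h.affine p hp, hs]
  abel

/-- The transformation law of Γ is the gauge relation with θ = dφ between Γ and its pullback along
φ. -/
lemma IsLocalAffineIsometry.curvature (hU : IsOpen U) {φ : OpenPartialHomeomorph Coord Coord}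
    (h : M.IsLocalAffineIsometry φ) {p : Coord} (hp : p ∈ φ.source) (u v w : Coord) :
    fderiv ℝ φ p (connCurvature M.Γ p u v w) =
      connCurvature M.Γ (φ p) (fderiv ℝ φ p u) (fderiv ℝ φ p v) (fderiv ℝ φ p w) := by
  have hΓ : ∀ x ∈ U, DifferentiableAt ℝ M.Γ x := fun x hx =>
    (M.Γ_smooth.contDiffAt (hU.mem_nhds hx)).differentiableAt (by simp)
  have hφ := h.contDiffAt hp
  have hφ₂ : ContDiffAt ℝ 2 (fderiv ℝ φ) p := hφ.fderiv_right (WithTop.coe_le_coe.2 le_top)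
  have hΓφ := hΓ _ (h.target_subset (φ.map_source hp))
  rw [← connCurvature_pullback hΓφ (hφ.of_le (WithTop.coe_le_coe.2 le_top))]
  refine connCurvature_gauge (hΓ p (h.source_subset hp)) ?_ hφ₂ ?_ u v w
  · exact (DifferentiableAt.comp p hΓφ (hφ.differentiableAt (by simp))).clm_comp
      (hφ₂.differentiableAt (by norm_num))
  · exact eventually_of_mem (φ.open_source.mem_nhds hp) fun x hx u v => h.affine x hx u v

/-- The Gödel coframe at a point, as a linear equivalence. -/
noncomputable def godelCoframeEquiv {H D : ℝ → ℝ} {p : Coord} (hD : D (p 1) ≠ 0) :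
    Coord ≃ₗ[ℝ] Coord where
  toLinearMap := (godelCoframe H D p).toLinearMap
  invFun := coframeInv (H (p 1)) (D (p 1))
  left_inv := coframeInv_godelCoframe hD
  right_inv := godelCoframe_coframeInv hD

/-- The differential of a local isometry expressed in the Gödel coframes is Lorentzian. -/
lemma IsLocalAffineIsometry.exists_lorentz (hg : M.HasGodelMetric H D)
    {φ : OpenPartialHomeomorph Coord Coord} (h : M.IsLocalAffineIsometry φ) {p : Coord}
    (hp : p ∈ φ.source) (hD : D (p 1) ≠ 0) :
    ∃ L : Coord →ₗ[ℝ] Coord, (∀ a b, lorentzInner (L a) (L b) = lorentzInner a b) ∧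
      ∀ u, L (godelCoframe H D p u) = godelCoframe H D (φ p) (fderiv ℝ φ p u) := by
  have hinv := coframeInv_godelCoframe (H := H) hD
  refine ⟨(godelCoframe H D (φ p)).toLinearMap ∘ₗ (fderiv ℝ φ p).toLinearMap ∘ₗ
    (godelCoframeEquiv (H := H) hD).symm.toLinearMap, fun a b => ?_, fun u => ?_⟩
  · obtain ⟨u, rfl⟩ := (godelCoframeEquiv (H := H) hD).surjective a
    obtain ⟨v, rfl⟩ := (godelCoframeEquiv (H := H) hD).surjective b
    simp only [LinearMap.comp_apply, LinearEquiv.coe_coe, LinearEquiv.symm_apply_apply]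
    have := h.isometry p hp u v
    rw [hg.g_apply (h.source_subset hp), hg.g_apply (h.target_subset (φ.map_source hp))] at this
    exact this
  · change godelCoframe H D (φ p) (fderiv ℝ φ p (coframeInv _ _ _)) = _
    rw [hinv]

/-- An inequality suffices, since homogeneity allows the two points to be exchanged. -/
lemma LocallyHomogeneous.torsion_sq_le (hM : M.LocallyHomogeneous) (hg : M.HasGodelMetric H D)
    (hT : M.HasPolarizedTorsion D S) (hD0 : ∀ p ∈ U, D (p 1) ≠ 0) {p q : Coord} (hp : p ∈ U)
    (hq : q ∈ U) : S (p 3) ^ 2 ≤ S (q 3) ^ 2 := by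
  obtain ⟨φ, hφ, hpφ, rfl⟩ := hM p hp q hq
  obtain ⟨L, hL, hLθ⟩ := hφ.exists_lorentz hg hpφ (hD0 p hp)
  refine sq_le_sq_of_lorentz_torsion hL fun a b => ?_
  obtain ⟨u, rfl⟩ := (godelCoframeEquiv (H := H) (hD0 p hp)).surjective a
  obtain ⟨v, rfl⟩ := (godelCoframeEquiv (H := H) (hD0 p hp)).surjective b
  change L (Pi.single 0 (S (p 3) * (godelCoframe H D p u 1 * godelCoframe H D p v 2 -
    godelCoframe H D p u 2 * godelCoframe H D p v 1))) = Pi.single 0 (S (φ p 3) *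
    (L (godelCoframe H D p u) 1 * L (godelCoframe H D p v) 2 -
    L (godelCoframe H D p u) 2 * L (godelCoframe H D p v) 1))
  have hs : ∀ (q : Coord) (r : ℝ), godelCoframe H D q (Pi.single 0 r) = Pi.single 0 r := by
    intro q r
    ext i
    fin_cases i <;> simp [godelCoframe_apply]
  have ht := hφ.torsion hpφ u v
  rw [hT p hp, hT _ hq] at ht
  have hθ : ∀ (q u v : Coord) (r : ℝ), r * (godelCoframe H D q u 1 * godelCoframe H D q v 2 -
      godelCoframe H D q u 2 * godelCoframe H D q v 1) =
      D (q 1) * r * (u 1 * v 2 - u 2 * v 1) := by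
    intro q u v r
    simp [godelCoframe_apply]
    ring
  rw [hLθ, hLθ, ← hs p, hLθ, hθ, hθ, ht, hs]

/-- Local homogeneity makes the characteristic polynomial of the Ricci tensor constant. -/
lemma LocallyHomogeneous.det_ricciPencil_eq (hU : IsOpen U) (hM : M.LocallyHomogeneous)
    (hg : M.HasGodelMetric H D) {s : ℝ} (hT : M.HasPolarizedTorsion D fun _ => s)
    (hH : ∀ p ∈ U, ContDiffAt ℝ ∞ H (p 1)) (hD : ∀ p ∈ U, ContDiffAt ℝ ∞ D (p 1))
    (hD0 : ∀ p ∈ U, D (p 1) ≠ 0) {w : ℝ → ℝ} (hw : w = fun x => deriv H x / D x - s)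
    {a b k : ℝ → ℝ} (ha : a = fun x => w x ^ 2 / 4) (hb : b = fun x => deriv w x / 2)
    (hk : k = fun x => 3 * w x ^ 2 / 4 + w x * s / 2 - deriv (deriv D) x / D x)
    {p q : Coord} (hp : p ∈ U) (hq : q ∈ U) (l : ℝ) :
    (ricciPencil (a (p 1)) (b (p 1)) (k (p 1)) l).det =
      (ricciPencil (a (q 1)) (b (q 1)) (k (q 1)) l).det := by
  -- The coframe is a gauge transformation from Γ to `godelConn`. The relation is needed on a whole
  -- neighbourhood with one function w of x alone, which is why the torsion factor must already be
  -- constant.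
  have hcurv : ∀ x ∈ U, ∀ u v c, godelCoframe H D x (connCurvature M.Γ x u v c) =
      frameCurvature (a (x 1)) (b (x 1)) (k (x 1)) (godelCoframe H D x u) (godelCoframe H D x v)
        (godelCoframe H D x c) := by
    intro x hx u v c
    have dH := (hH x hx).differentiableAt (by simp)
    have dD := (hD x hx).differentiableAt (by simp)
    have dH' : DifferentiableAt ℝ (deriv H) (x 1) :=
      ((hH x hx).derivWithin (m := 1) (WithTop.coe_le_coe.2 le_top)).differentiableAt (by simp)
    have dD' : DifferentiableAt ℝ (deriv D) (x 1) :=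
      ((hD x hx).derivWithin (m := 1) (WithTop.coe_le_coe.2 le_top)).differentiableAt (by simp)
    have dw : DifferentiableAt ℝ w (x 1) := by
      rw [hw]
      exact (dH'.div dD (hD0 x hx)).sub_const s
    have hB := hasFDerivAt_godelConn dH.hasDerivAt dD.hasDerivAt dD'.hasDerivAt dw.hasDerivAt
    have hΓ : DifferentiableAt ℝ M.Γ x :=
      (M.Γ_smooth.contDiffAt (hU.mem_nhds hx)).differentiableAt (by simp)
    have hθ : ContDiffAt ℝ 2 (godelCoframe H D) x := by
      have e : ContDiffAt ℝ ∞ (fun p : Coord => p 1) x := by fun_prop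
      have e₁ : ContDiffAt ℝ 2 (fun p : Coord => H (p 1)) x :=
        (ContDiffAt.comp x (hH x hx) e).of_le (WithTop.coe_le_coe.2 le_top)
      have e₂ : ContDiffAt ℝ 2 (fun p : Coord => D (p 1)) x :=
        (ContDiffAt.comp x (hD x hx) e).of_le (WithTop.coe_le_coe.2 le_top)
      exact (contDiffAt_const.add (e₁.smul contDiffAt_const)).add (e₂.smul contDiffAt_const)
    rw [connCurvature_gauge hΓ hB.differentiableAt hθ ?_ u v c,
      connCurvature_godelConn (s := s) (K := deriv (deriv D) (x 1) / D (x 1)) ?_ dD.hasDerivAt ?_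
        dw.hasDerivAt, ha, hb, hk]
    · rw [hw]
      simpa [hD0 x hx] using dH.hasDerivAt
    · rw [div_mul_cancel₀ _ (hD0 x hx)]
      exact dD'.hasDerivAt
    · refine eventually_of_mem (hU.mem_nhds hx) fun y hy u v => ?_
      rw [hg.godelCoframe_Γ hU hT hy ((hH y hy).differentiableAt (by simp))
        ((hD y hy).differentiableAt (by simp)) (hD0 y hy), hw]
  obtain ⟨φ, hφ, hpφ, rfl⟩ := hM p hp q hq
  obtain ⟨L, hL, hLθ⟩ := hφ.exists_lorentz hg hpφ (hD0 p hp)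
  refine _root_.det_ricciPencil_eq hL (fun a' b' c' => ?_) l
  obtain ⟨u, rfl⟩ := (godelCoframeEquiv (H := H) (hD0 p hp)).surjective a'
  obtain ⟨v, rfl⟩ := (godelCoframeEquiv (H := H) (hD0 p hp)).surjective b'
  obtain ⟨c, rfl⟩ := (godelCoframeEquiv (H := H) (hD0 p hp)).surjective c'
  change L (frameCurvature _ _ _ (godelCoframe H D p u) (godelCoframe H D p v)
    (godelCoframe H D p c)) = frameCurvature _ _ _ (L (godelCoframe H D p u))
    (L (godelCoframe H D p v)) (L (godelCoframe H D p c))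
  rw [← hcurv p hp, hLθ, hLθ, hLθ, hLθ, hφ.curvature hU hpφ, hcurv _ hq]

end RiemannCartan

lemma isOpen_image_coord {U : Set Coord} (hU : IsOpen U) (i : Fin 4) :
    IsOpen ((fun p : Coord => p i) '' U) :=
  isOpenMap_eval i U hU

/-- The roots of the Ricci characteristic polynomial form a finite set. -/
lemma finite_roots_ricciPencil (α β κ : ℝ) : {l : ℝ | (ricciPencil α β κ l).det = 0}.Finite := by
  let P : Polynomial ℝ := Polynomial.X * (Polynomial.X - Polynomial.C (α - κ)) *
    ((Polynomial.C (2 * α) - Polynomial.X) * (Polynomial.X - Polynomial.C (α - κ)) -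
      Polynomial.C (β ^ 2))
  have hP : P ≠ 0 := by
    have : P.natDegree = 4 := by
      unfold P
      compute_degree!
    intro h
    simp [h] at this
  refine (P.rootSet_finite ℝ).subset fun l hl => ?_
  rw [Polynomial.mem_rootSet_of_ne hP]
  rw [Set.mem_ofPred_eq, det_ricciPencil] at hl
  simpa [P] using hl

/-- The parameter `α` is determined by the double eigenvalue `α - κ` and the characteristic
polynomial of the Ricci tensor. -/
lemma eq_of_det_ricciPencil_eq {α β κ α' β' κ' : ℝ} (hν : α - κ = α' - κ')
    (h : ∀ l, (ricciPencil α β κ l).det = (ricciPencil α' β' κ' l).det) : α = α' := by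
  have key : ∀ l, 0 < l → 0 < l - (α - κ) →
      (2 * α - l) * (l - (α - κ)) - β ^ 2 = (2 * α' - l) * (l - (α - κ)) - β' ^ 2 := by
    intro l h₁ h₂
    have := h l
    rw [det_ricciPencil, det_ricciPencil, ← hν] at this
    exact mul_left_cancel₀ (mul_pos h₁ h₂).ne' this
  have a := abs_nonneg (α - κ)
  have b := le_abs_self (α - κ)
  -- Both values of l avoid the roots 0 and α - κ, so the common factors cancel. Subtracting the two
  -- identities removes β² and isolates α.
  have k₁ := key (|α - κ| + 1) (by linarith) (by linarith)
  have k₂ := key (|α - κ| + 2) (by linarith) (by linarith)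
  linarith

namespace RiemannCartan

variable {U : Set Coord} {M : RiemannCartan U} {H D S : ℝ → ℝ}

/-- The conditions on `H`, `D`, `S` forced by local homogeneity. -/
theorem LocallyHomogeneous.constants (hU : IsOpen U) (hUc : IsConnected U)
    (hH : ContDiffOn ℝ ∞ H ((fun p : Coord => p 1) '' U))
    (hD : ContDiffOn ℝ ∞ D ((fun p : Coord => p 1) '' U))
    (hS : ContDiffOn ℝ ∞ S ((fun p : Coord => p 3) '' U))
    (hD0 : ∀ x ∈ (fun p : Coord => p 1) '' U, D x ≠ 0)
    (hg : M.HasGodelMetric H D) (hT : M.HasPolarizedTorsion D S) (hM : M.LocallyHomogeneous) :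
    (∃ ω₀ : ℝ, ∀ x ∈ (fun p : Coord => p 1) '' U, deriv H x / D x = 2 * ω₀) ∧
    (∃ m2 : ℝ, ∀ x ∈ (fun p : Coord => p 1) '' U, deriv (deriv D) x / D x = m2) ∧
    (∃ S₀ : ℝ, ∀ z ∈ (fun p : Coord => p 3) '' U, S z = S₀) := by
  obtain ⟨p₀, hp₀⟩ := hUc.nonempty
  set I := (fun p : Coord => p 1) '' U with hI_def
  have hI : IsOpen I := isOpen_image_coord hU 1
  have hIc : IsPreconnected I := hUc.isPreconnected.image _ (by fun_prop)
  have hJc : IsPreconnected ((fun p : Coord => p 3) '' U) :=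
    hUc.isPreconnected.image _ (by fun_prop)
  have hIU : ∀ p ∈ U, p 1 ∈ I := fun p hp => ⟨p, hp, rfl⟩
  have hD0' : ∀ p ∈ U, D (p 1) ≠ 0 := fun p hp => hD0 _ (hIU p hp)
  have hSc : ∀ z ∈ (fun p : Coord => p 3) '' U, S z = S (p₀ 3) := by
    intro z hz
    refine hJc.eq_of_finite_image hS.continuousOn (Set.toFinite {S (p₀ 3), -S (p₀ 3)}) ?_ hz
      ⟨p₀, hp₀, rfl⟩
    rintro _ ⟨p, hp, rfl⟩
    exact sq_eq_sq_iff_eq_or_eq_neg.1 (le_antisymm (hM.torsion_sq_le hg hT hD0' hp hp₀)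
      (hM.torsion_sq_le hg hT hD0' hp₀ hp))
  have hT' : M.HasPolarizedTorsion D fun _ => S (p₀ 3) := by
    intro p hp u v
    rw [hT p hp, hSc _ ⟨p, hp, rfl⟩]
  set s := S (p₀ 3)
  have cH' : ContinuousOn (deriv H) I :=
    (hH.deriv_of_isOpen (m := 1) hI (WithTop.coe_le_coe.2 le_top)).continuousOn
  have cD' : ContDiffOn ℝ ∞ (deriv D) I := hD.deriv_of_isOpen hI le_rfl
  have cD'' : ContinuousOn (deriv (deriv D)) I :=
    (cD'.deriv_of_isOpen (m := 1) hI (WithTop.coe_le_coe.2 le_top)).continuousOn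
  obtain ⟨w, hw⟩ : ∃ w : ℝ → ℝ, w = fun x => deriv H x / D x - s := ⟨_, rfl⟩
  obtain ⟨a, ha⟩ : ∃ a : ℝ → ℝ, a = fun x => w x ^ 2 / 4 := ⟨_, rfl⟩
  obtain ⟨b, hb⟩ : ∃ b : ℝ → ℝ, b = fun x => deriv w x / 2 := ⟨_, rfl⟩
  obtain ⟨k, hk⟩ : ∃ k : ℝ → ℝ,
    k = fun x => 3 * w x ^ 2 / 4 + w x * s / 2 - deriv (deriv D) x / D x := ⟨_, rfl⟩
  have cw : ContinuousOn w I := by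
    rw [hw]
    exact (cH'.div hD.continuousOn hD0).sub continuousOn_const
  have ca : ContinuousOn a I := by
    rw [ha]
    exact (cw.pow 2).div_const 4
  have ck : ContinuousOn k I := by
    rw [hk]
    exact ((((cw.pow 2).const_mul 3).div_const 4).add ((cw.mul_const s).div_const 2)).sub
      (cD''.div hD.continuousOn hD0)
  have hdet : ∀ x ∈ I, ∀ y ∈ I, ∀ l,
      (ricciPencil (a x) (b x) (k x) l).det = (ricciPencil (a y) (b y) (k y) l).det := by
    rintro _ ⟨p, hp, rfl⟩ _ ⟨q, hq, rfl⟩ l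
    exact hM.det_ricciPencil_eq hU hg hT' (fun p hp => hH.contDiffAt (hI.mem_nhds (hIU p hp)))
      (fun p hp => hD.contDiffAt (hI.mem_nhds (hIU p hp))) hD0' hw ha hb hk hp hq l
  have hx₀ := hIU p₀ hp₀
  -- The value of a - k at any point is a root of the polynomial at that point, which is the
  -- polynomial at `p₀`. A continuous function with values in this finite set is constant.
  have hν : ∀ x ∈ I, a x - k x = a (p₀ 1) - k (p₀ 1) := by
    intro x hx
    refine hIc.eq_of_finite_image (f := fun x => a x - k x) (ca.sub ck)
      (finite_roots_ricciPencil (a (p₀ 1)) (b (p₀ 1)) (k (p₀ 1))) ?_ hx hx₀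
    intro y hy
    rw [Set.mem_ofPred_eq, ← hdet y hy _ hx₀, det_ricciPencil, sub_self, mul_zero, zero_mul]
  have hac : ∀ x ∈ I, a x = a (p₀ 1) := fun x hx =>
    eq_of_det_ricciPencil_eq (hν x hx) (hdet x hx _ hx₀)
  have hwc : ∀ x ∈ I, w x = w (p₀ 1) := by
    intro x hx
    refine hIc.eq_of_finite_image cw (Set.toFinite {w (p₀ 1), -w (p₀ 1)}) ?_ hx hx₀
    intro y hy
    have := hac y hy
    simp only [ha] at this
    exact sq_eq_sq_iff_eq_or_eq_neg.1 (by linarith)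
  refine ⟨⟨(w (p₀ 1) + s) / 2, fun x hx => ?_⟩,
    ⟨3 * w (p₀ 1) ^ 2 / 4 + w (p₀ 1) * s / 2 - k (p₀ 1), fun x hx => ?_⟩, ⟨s, hSc⟩⟩
  · have := hwc x hx
    rw [← this, hw]
    ring
  · have h₁ : k x = k (p₀ 1) := by linarith [hν x hx, hac x hx]
    rw [← h₁, ← hwc x hx, hk]
    ring

end RiemannCartan

/-! ### Charts to the homogeneous model give affine isometries -/

/-- Inverse function theorem for smooth maps with injective differentials. -/
lemma exists_chart_of_injective_fderiv {f : Coord → Coord} {V : Set Coord} (hV : IsOpen V)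
    (hf : ContDiffOn ℝ ∞ f V) (hinj : ∀ x ∈ V, Function.Injective (fderiv ℝ f x)) {p : Coord}
    (hp : p ∈ V) :
    ∃ Ψ : OpenPartialHomeomorph Coord Coord, (Ψ : Coord → Coord) = f ∧ p ∈ Ψ.source ∧
      Ψ.source ⊆ V ∧ ContDiffOn ℝ ∞ Ψ.symm Ψ.target := by
  have he : ∀ x ∈ V, ∃ e : Coord ≃L[ℝ] Coord, HasFDerivAt f (e : Coord →L[ℝ] Coord) x := by
    intro x hx
    refine ⟨(LinearEquiv.ofInjectiveEndo (fderiv ℝ f x).toLinearMap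
      (hinj x hx)).toContinuousLinearEquiv, ?_⟩
    exact ((hf.contDiffAt (hV.mem_nhds hx)).differentiableAt (by simp)).hasFDerivAt.congr_fderiv
      (by ext; rfl)
  obtain ⟨e, hep⟩ := he p hp
  let Ψ := ((hf.contDiffAt (hV.mem_nhds hp)).toOpenPartialHomeomorph f hep (by simp)).restrOpen V hV
  refine ⟨Ψ, rfl, ⟨ContDiffAt.mem_toOpenPartialHomeomorph_source _ hep _, hp⟩, fun x hx => hx.2,
    fun y hy => ?_⟩
  have hx : Ψ.symm y ∈ V := (Ψ.map_target hy).2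
  obtain ⟨e', he'⟩ := he _ hx
  exact (Ψ.contDiffAt_symm hy he' (hf.contDiffAt (hV.mem_nhds hx))).contDiffWithinAt

/-- The derivative of a bilinear form field that is preserved by a map. -/
lemma fderiv_of_pullback_eq {E : Type*} [NormedAddCommGroup E] [NormedSpace ℝ E]
    {g : E → E →L[ℝ] E →L[ℝ] ℝ} {φ : E → E} {p : E} (hg : DifferentiableAt ℝ g p)
    (hg' : DifferentiableAt ℝ g (φ p)) (hφ₁ : DifferentiableAt ℝ φ p)
    (hφ₂ : DifferentiableAt ℝ (fderiv ℝ φ) p)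
    (h : ∀ᶠ x in 𝓝 p, ∀ u v, g (φ x) (fderiv ℝ φ x u) (fderiv ℝ φ x v) = g x u v) (u v w : E) :
    fderiv ℝ g p u v w =
      fderiv ℝ g (φ p) (fderiv ℝ φ p u) (fderiv ℝ φ p v) (fderiv ℝ φ p w) +
      g (φ p) (fderiv ℝ (fderiv ℝ φ) p u v) (fderiv ℝ φ p w) +
      g (φ p) (fderiv ℝ φ p v) (fderiv ℝ (fderiv ℝ φ) p u w) := by
  have e₁ := (hg.hasFDerivAt.clm_apply (hasFDerivAt_const v p)).clm_apply (hasFDerivAt_const w p)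
  have e₀ := HasFDerivAt.comp (g := g) (f := φ) p hg'.hasFDerivAt hφ₁.hasFDerivAt
  rw [Function.comp_def] at e₀
  have e₂ := (e₀.clm_apply (hφ₂.hasFDerivAt.clm_apply (hasFDerivAt_const v p))).clm_apply
    (hφ₂.hasFDerivAt.clm_apply (hasFDerivAt_const w p))
  have e₃ := e₁.unique (e₂.congr_of_eventuallyEq (h.mono fun x hx => (hx v w).symm))
  have e₄ := DFunLike.congr_fun e₃ u
  simp at e₄
  rw [e₄]
  abel

namespace RiemannCartan

variable {U : Set Coord} {M : RiemannCartan U}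

/-- A local isometry which preserves the torsion preserves the connection. -/
lemma isLocalAffineIsometry_of_torsion (hU : IsOpen U) {φ : OpenPartialHomeomorph Coord Coord}
    (hs : φ.source ⊆ U) (ht : φ.target ⊆ U) (hφ : ContDiffOn ℝ ∞ φ φ.source)
    (hφ' : ContDiffOn ℝ ∞ φ.symm φ.target)
    (hg : ∀ p ∈ φ.source, ∀ u v,
      M.g (φ p) (fderiv ℝ φ p u) (fderiv ℝ φ p v) = M.g p u v)
    (hT : ∀ p ∈ φ.source, ∀ u v,
      fderiv ℝ φ p (M.torsion p u v) = M.torsion (φ p) (fderiv ℝ φ p u) (fderiv ℝ φ p v)) :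
    M.IsLocalAffineIsometry φ := by
  refine ⟨hs, ht, hφ, hφ', hg, fun p hp u v => ?_⟩
  have hq := φ.map_source hp
  have hφp : ContDiffAt ℝ ∞ φ p := hφ.contDiffAt (φ.open_source.mem_nhds hp)
  have hφ₁ : DifferentiableAt ℝ φ p := hφp.differentiableAt (by simp)
  have hφ₂ : DifferentiableAt ℝ (fderiv ℝ φ) p :=
    (hφp.fderiv_right (m := 1) (WithTop.coe_le_coe.2 le_top)).differentiableAt (by norm_num)
  have hsymm : ∀ u v, fderiv ℝ (fderiv ℝ φ) p u v = fderiv ℝ (fderiv ℝ φ) p v u := fun u v =>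
    hφp.isSymmSndFDerivAt (by simp; exact ENat.LEInfty.out) u v
  -- Surjectivity of dφ allows nondegeneracy at φ(p) to be tested on vectors dφ(w) only.
  have hsurj : ∀ y, ∃ x, fderiv ℝ φ p x = y := by
    intro y
    have h₁ : DifferentiableAt ℝ φ.symm (φ p) :=
      (hφ'.contDiffAt (φ.open_target.mem_nhds hq)).differentiableAt (by simp)
    have h₂ : HasFDerivAt (fun y => φ (φ.symm y)) ((fderiv ℝ φ p).comp (fderiv ℝ φ.symm (φ p)))
        (φ p) := by
      refine HasFDerivAt.comp _ ?_ h₁.hasFDerivAt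
      rw [φ.left_inv hp]
      exact hφ₁.hasFDerivAt
    have h₃ := h₂.unique ((hasFDerivAt_id (φ p)).congr_of_eventuallyEq
      (eventually_of_mem (φ.open_target.mem_nhds hq) fun y hy => φ.right_inv hy))
    exact ⟨fderiv ℝ φ.symm (φ p) y, DFunLike.congr_fun h₃ y⟩
  have hgd : ∀ x ∈ U, DifferentiableAt ℝ M.g x := fun x hx =>
    (M.g_smooth.contDiffAt (hU.mem_nhds hx)).differentiableAt (by simp)
  have hder : ∀ u v w, fderiv ℝ M.g p u v w =
      fderiv ℝ M.g (φ p) (fderiv ℝ φ p u) (fderiv ℝ φ p v) (fderiv ℝ φ p w) +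
      M.g (φ p) (fderiv ℝ (fderiv ℝ φ) p u v) (fderiv ℝ φ p w) +
      M.g (φ p) (fderiv ℝ φ p v) (fderiv ℝ (fderiv ℝ φ) p u w) := by
    intro u v w
    exact fderiv_of_pullback_eq (hgd p (hs hp)) (hgd _ (ht hq)) hφ₁ hφ₂
      (eventually_of_mem (φ.open_source.mem_nhds hp) hg) u v w
  rw [← sub_eq_zero]
  refine M.g_nondegenerate (ht hq) fun y => ?_
  obtain ⟨w, rfl⟩ := hsurj y
  -- The defect in the transformation law is again symmetric by the torsion and skew by the
  -- derivative of the isometry relation.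
  refine eq_zero_of_symm_of_skew (fun u v w => M.g (φ p) (fderiv ℝ φ p (M.Γ p u v) -
    (fderiv ℝ (fderiv ℝ φ) p u v + M.Γ (φ p) (fderiv ℝ φ p u) (fderiv ℝ φ p v)))
    (fderiv ℝ φ p w)) ?_ ?_ u v w
  · intro u v w
    have h := hT p hp u v
    simp only [torsion, map_sub] at h
    have h' : fderiv ℝ φ p (M.Γ p u v) - (fderiv ℝ (fderiv ℝ φ) p u v +
        M.Γ (φ p) (fderiv ℝ φ p u) (fderiv ℝ φ p v)) = fderiv ℝ φ p (M.Γ p v u) -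
        (fderiv ℝ (fderiv ℝ φ) p v u + M.Γ (φ p) (fderiv ℝ φ p v) (fderiv ℝ φ p u)) := by
      rw [hsymm v u, ← sub_sub, ← sub_sub, sub_right_comm, sub_right_comm _ _ (M.Γ _ _ _)]
      congr 1
      rwa [sub_eq_sub_iff_sub_eq_sub]
    simp only [h']
  · intro u v w
    have h := hder u v w
    rw [M.g_parallel p (hs hp), M.g_parallel _ (ht hq), ← hg p hp, ← hg p hp] at h
    have h₁ := M.g_symm _ (ht hq) (fderiv ℝ φ p v) (fderiv ℝ φ p (M.Γ p u w))
    have h₂ := M.g_symm _ (ht hq) (fderiv ℝ φ p v) (fderiv ℝ (fderiv ℝ φ) p u w)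
    have h₃ := M.g_symm _ (ht hq) (fderiv ℝ φ p v)
      (M.Γ (φ p) (fderiv ℝ φ p u) (fderiv ℝ φ p w))
    simp only [map_sub, map_add, FunLike.coe_sub, FunLike.coe_add, Pi.sub_apply, Pi.add_apply]
    linarith

end RiemannCartan

/-- The function `ρ = √(1 + m2 r ^ 2)` of the model plane of curvature `-m2`. -/
noncomputable def modelRho (m2 : ℝ) (X : Coord) : ℝ := √(1 + m2 * (X 1 ^ 2 + X 2 ^ 2))

/-- The metric of the homogeneous model. -/
noncomputable def modelForm (m2 w : ℝ) (X V : Coord) : ℝ :=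
  (V 0 + 2 * w * (X 1 * V 2 - X 2 * V 1) / (1 + modelRho m2 X)) ^ 2 -
    (V 1 ^ 2 + V 2 ^ 2 - m2 * (X 1 * V 1 + X 2 * V 2) ^ 2 / modelRho m2 X ^ 2) - V 3 ^ 2

/-- The horizontal area form of the homogeneous model. -/
noncomputable def modelArea (m2 : ℝ) (X V W : Coord) : ℝ :=
  (V 1 * W 2 - V 2 * W 1) / modelRho m2 X

namespace RiemannCartan

variable {U : Set Coord} {M : RiemannCartan U}

/-- A chart that brings the metric `M.g` and the horizontal area form `D dx ∧ dy` to the form they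
have in the homogeneous model. -/
structure IsModelChart (M : RiemannCartan U) (D : ℝ → ℝ) (m2 w : ℝ)
    (Ψ : OpenPartialHomeomorph Coord Coord) : Prop where
  source_subset : Ψ.source ⊆ U
  smooth : ContDiffOn ℝ ∞ Ψ Ψ.source
  smooth_symm : ContDiffOn ℝ ∞ Ψ.symm Ψ.target
  injective : ∀ p ∈ Ψ.source, Function.Injective (fderiv ℝ Ψ p)
  metric : ∀ p ∈ Ψ.source, ∀ u, modelForm m2 w (Ψ p) (fderiv ℝ Ψ p u) = M.g p u u
  area : ∀ p ∈ Ψ.source, ∀ u v,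
    modelArea m2 (Ψ p) (fderiv ℝ Ψ p u) (fderiv ℝ Ψ p v) = D (p 1) * (u 1 * v 2 - u 2 * v 1)
  time : ∀ p ∈ Ψ.source, fderiv ℝ Ψ p (Pi.single 0 1) = Pi.single 0 1

/-- The torsion is s times the area form D dx ∧ dy tensored with ∂ₜ, and the transition map
preserves both factors. -/
lemma IsModelChart.isLocalAffineIsometry (hU : IsOpen U) {D : ℝ → ℝ} {s : ℝ}
    (hT : M.HasPolarizedTorsion D fun _ => s) {m2 w : ℝ} {Ψ Φ : OpenPartialHomeomorph Coord Coord}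
    (hΨ : M.IsModelChart D m2 w Ψ) (hΦ : M.IsModelChart D m2 w Φ) :
    M.IsLocalAffineIsometry (Ψ.trans Φ.symm) := by
  set φ := Ψ.trans Φ.symm with hφ_def
  have hsub : ∀ p ∈ φ.source, p ∈ Ψ.source := fun p hp => hp.1
  have hmem : ∀ p ∈ φ.source, φ p ∈ Φ.source := fun p hp => Φ.map_target hp.2
  have hΦφ : ∀ p ∈ φ.source, Φ (φ p) = Ψ p := fun p hp => Φ.right_inv hp.2
  have hφs : ContDiffOn ℝ ∞ φ φ.source :=
    hΦ.smooth_symm.comp (hΨ.smooth.mono hsub) fun p hp => hp.2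
  have hd : ∀ p ∈ φ.source, ∀ u, fderiv ℝ Φ (φ p) (fderiv ℝ φ p u) = fderiv ℝ Ψ p u := by
    intro p hp u
    have h₁ : DifferentiableAt ℝ φ p :=
      (hφs.contDiffAt (φ.open_source.mem_nhds hp)).differentiableAt (by simp)
    have h₂ : DifferentiableAt ℝ Φ (φ p) :=
      (hΦ.smooth.contDiffAt (Φ.open_source.mem_nhds (hmem p hp))).differentiableAt (by simp)
    have h₃ : DifferentiableAt ℝ Ψ p :=
      (hΨ.smooth.contDiffAt (Ψ.open_source.mem_nhds (hsub p hp))).differentiableAt (by simp)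
    have h₄ := (h₂.hasFDerivAt.comp p h₁.hasFDerivAt).unique
      (h₃.hasFDerivAt.congr_of_eventuallyEq
        (eventually_of_mem (φ.open_source.mem_nhds hp) fun x hx => hΦφ x hx))
    exact DFunLike.congr_fun h₄ u
  have hsU : φ.source ⊆ U := fun p hp => hΨ.source_subset hp.1
  have htU : φ.target ⊆ U := fun y hy => hΦ.source_subset (by
    have := hmem _ (φ.map_target hy)
    rwa [φ.right_inv hy] at this)
  have hquad : ∀ p ∈ φ.source, ∀ u,
      M.g (φ p) (fderiv ℝ φ p u) (fderiv ℝ φ p u) = M.g p u u := by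
    intro p hp u
    rw [← hΦ.metric _ (hmem p hp), ← hΨ.metric p (hsub p hp), hd p hp, hΦφ p hp]
  refine isLocalAffineIsometry_of_torsion hU hsU htU hφs ?_ ?_ ?_
  · exact hΨ.smooth_symm.comp (hΦ.smooth.mono fun y hy => hy.1) fun y hy => hy.2
  · intro p hp u v
    have h₁ := hquad p hp (u + v)
    have h₂ := hquad p hp u
    have h₃ := hquad p hp v
    have h₄ := M.g_symm p (hsU hp) u v
    have h₅ := M.g_symm (φ p) (htU (φ.map_source hp)) (fderiv ℝ φ p u) (fderiv ℝ φ p v)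
    simp only [map_add, FunLike.coe_add, Pi.add_apply] at h₁
    linarith
  · intro p hp u v
    have ht : fderiv ℝ φ p (Pi.single 0 1) = Pi.single 0 1 := by
      apply hΦ.injective _ (hmem p hp)
      rw [hd p hp, hΨ.time p (hsub p hp), hΦ.time _ (hmem p hp)]
    have hs : ∀ r : ℝ, (Pi.single 0 r : Coord) = r • (Pi.single 0 1 : Coord) := by
      intro r
      rw [← Pi.single_smul, smul_eq_mul, mul_one]
    have ha := hΦ.area _ (hmem p hp) (fderiv ℝ φ p u) (fderiv ℝ φ p v)
    rw [hd p hp, hd p hp, hΦφ p hp, hΨ.area p (hsub p hp)] at ha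
    rw [hT p (hsU hp), hT _ (htU (φ.map_source hp)), hs, map_smul, ht, ← hs]
    congr 1
    linear_combination s * ha

end RiemannCartan

/-! ### Surfaces of constant curvature as quadrics -/

/-- The generalized trigonometric functions: `S'' = k S` and `Q' = S`. -/
lemma exists_generalized_trig (k : ℝ) : ∃ Q S : ℝ → ℝ, ContDiff ℝ ∞ Q ∧ ContDiff ℝ ∞ S ∧
    (∀ x, HasDerivAt Q (S x) x) ∧ (∀ x, HasDerivAt S (1 + k * Q x) x) ∧ Q 0 = 0 ∧ S 0 = 0 ∧
    ∀ x, S x ^ 2 = 2 * Q x + k * Q x ^ 2 := by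
  rcases lt_trichotomy k 0 with hk | rfl | hk
  · obtain ⟨a, ha, rfl⟩ : ∃ a : ℝ, 0 < a ∧ k = -a ^ 2 :=
      ⟨√(-k), Real.sqrt_pos.2 (by linarith), by rw [Real.sq_sqrt (by linarith)]; ring⟩
    refine ⟨fun x => (1 - Real.cos (a * x)) / a ^ 2, fun x => Real.sin (a * x) / a,
      by fun_prop, by fun_prop, fun x => ?_, fun x => ?_, by simp, by simp, fun x => ?_⟩
    · have h := (((hasDerivAt_id x).const_mul a).cos.const_sub 1).div_const (a ^ 2)
      refine h.congr_deriv ?_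
      simp
      field_simp
    · have h := ((hasDerivAt_id x).const_mul a).sin.div_const a
      refine h.congr_deriv ?_
      simp
      field_simp
      ring
    · have := Real.sin_sq_add_cos_sq (a * x)
      field_simp
      linear_combination this
  · refine ⟨fun x => x ^ 2 / 2, fun x => x, by fun_prop, by fun_prop, fun x => ?_, fun x => ?_,
      by simp, rfl, fun x => by ring⟩
    · exact ((hasDerivAt_pow 2 x).div_const 2).congr_deriv (by simp)
    · exact (hasDerivAt_id x).congr_deriv (by simp)
  · obtain ⟨a, ha, rfl⟩ : ∃ a : ℝ, 0 < a ∧ k = a ^ 2 :=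
      ⟨√k, Real.sqrt_pos.2 hk, by rw [Real.sq_sqrt hk.le]⟩
    refine ⟨fun x => (Real.cosh (a * x) - 1) / a ^ 2, fun x => Real.sinh (a * x) / a,
      by fun_prop, by fun_prop, fun x => ?_, fun x => ?_, by simp, by simp, fun x => ?_⟩
    · have h := (((hasDerivAt_id x).const_mul a).cosh.sub_const 1).div_const (a ^ 2)
      refine h.congr_deriv ?_
      simp
      field_simp
    · have h := ((hasDerivAt_id x).const_mul a).sinh.div_const a
      refine h.congr_deriv ?_
      simp
      field_simp
      ring
    · have := Real.cosh_sq (a * x)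
      field_simp
      linear_combination -this

/-- A solution of `D'' = m2 D` on a preconnected open set is determined by its value and derivative
at a point. -/
lemma eq_of_deriv_deriv_eq_mul {I : Set ℝ} (hI : IsOpen I) (hIc : IsPreconnected I) {m2 : ℝ}
    {f g f' g' : ℝ → ℝ} (hf : ∀ x ∈ I, HasDerivAt f (f' x) x)
    (hf' : ∀ x ∈ I, HasDerivAt f' (m2 * f x) x) (hg : ∀ x ∈ I, HasDerivAt g (g' x) x)
    (hg' : ∀ x ∈ I, HasDerivAt g' (m2 * g x) x) {x₀ : ℝ} (hx₀ : x₀ ∈ I) (h₀ : f x₀ = g x₀)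
    (h₁ : f' x₀ = g' x₀) {x : ℝ} (hx : x ∈ I) : f x = g x := by
  obtain ⟨Q, S, -, -, hQ, hS, hQ₀, hS₀, hQS⟩ := exists_generalized_trig m2
  have hc : ∀ F : ℝ → ℝ, (∀ y ∈ I, HasDerivAt F 0 y) → F x = F x₀ := fun F hF =>
    hI.is_const_of_deriv_eq_zero hIc
      (fun y hy => (hF y hy).differentiableAt.differentiableWithinAt)
      (fun y hy => (hF y hy).deriv) hx hx₀
  -- With C = 1 + m2 Q, the function `e₁` and its companion `e₂` are first integrals of the equation
  -- for f - g. Both vanish at `x₀`, and C² - m2 S² = 1 allows them to be solved for f - g.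
  have e₁ := hc (fun y => (f y - g y) * (1 + m2 * Q (y - x₀)) - (f' y - g' y) * S (y - x₀)) (by
    intro y hy
    have q := (hQ (y - x₀)).comp_sub_const y x₀
    have s := (hS (y - x₀)).comp_sub_const y x₀
    refine HasDerivAt.congr_deriv ((((hf y hy).sub (hg y hy)).mul ((q.const_mul m2).const_add 1)).sub
      (((hf' y hy).sub (hg' y hy)).mul s)) ?_
    simp
    ring)
  have e₂ := hc (fun y => (f' y - g' y) * (1 + m2 * Q (y - x₀)) -
      m2 * (f y - g y) * S (y - x₀)) (by
    intro y hy
    have q := (hQ (y - x₀)).comp_sub_const y x₀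
    have s := (hS (y - x₀)).comp_sub_const y x₀
    refine HasDerivAt.congr_deriv ((((hf' y hy).sub (hg' y hy)).mul ((q.const_mul m2).const_add 1)).sub
      ((((hf y hy).sub (hg y hy)).const_mul m2).mul s)) ?_
    simp
    ring)
  simp only [h₀, h₁, sub_self, zero_mul, mul_zero] at e₁ e₂
  have := hQS (x - x₀)
  linear_combination (1 + m2 * Q (x - x₀)) * e₁ + S (x - x₀) * e₂ + (f x - g x) * m2 * this

/-- The hyperboloid coordinates around a point of the surface `dx² + D² dy²` with `D'' = m2 D`. -/
lemma exists_hyperboloid_coords (m2 : ℝ) {I : Set ℝ} (hI : IsOpen I) (hIc : IsPreconnected I)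
    {D D' : ℝ → ℝ} (hD : ∀ x ∈ I, HasDerivAt D (D' x) x)
    (hD' : ∀ x ∈ I, HasDerivAt D' (m2 * D x) x) {p₀ : Coord} (hp₀ : p₀ 1 ∈ I) :
    ∃ f₀ f₁ f₂ : Coord → ℝ, ContDiff ℝ ∞ f₀ ∧ ContDiff ℝ ∞ f₁ ∧ ContDiff ℝ ∞ f₂ ∧
      f₀ p₀ = 1 ∧ f₁ p₀ = 0 ∧ f₂ p₀ = 0 ∧ (∀ p, f₀ p ^ 2 = 1 + m2 * (f₁ p ^ 2 + f₂ p ^ 2)) ∧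
      (∀ p, fderiv ℝ f₁ p (Pi.single 0 1) = 0) ∧ (∀ p, fderiv ℝ f₂ p (Pi.single 0 1) = 0) ∧
      (∀ p, p 1 ∈ I → ∀ u v, fderiv ℝ f₁ p u * fderiv ℝ f₂ p v - fderiv ℝ f₂ p u * fderiv ℝ f₁ p v =
        f₀ p * D (p 1) * (u 1 * v 2 - u 2 * v 1)) ∧
      (∀ p, p 1 ∈ I → ∀ u, fderiv ℝ f₁ p u ^ 2 + fderiv ℝ f₂ p u ^ 2 +
        m2 * (f₁ p * fderiv ℝ f₂ p u - f₂ p * fderiv ℝ f₁ p u) ^ 2 =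
        f₀ p ^ 2 * (u 1 ^ 2 + D (p 1) ^ 2 * u 2 ^ 2)) := by
  obtain ⟨d, hd⟩ : ∃ d, d = D (p₀ 1) := ⟨_, rfl⟩
  obtain ⟨d', hd'⟩ : ∃ d', d' = D' (p₀ 1) := ⟨_, rfl⟩
  obtain ⟨P, S, cP, cS, hP, hS, hP₀, hS₀, hPS⟩ := exists_generalized_trig m2
  -- This is the value of the first integral D'² - m2 D². Translations in y act on the ambient space
  -- of the quadric by a linear one-parameter group whose generator X satisfies X³ = -kX, hence the
  -- functions with parameter -k.
  obtain ⟨k, hk⟩ : ∃ k, k = d' ^ 2 - m2 * d ^ 2 := ⟨_, rfl⟩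
  obtain ⟨Q, s, cQ, cs, hQ, hs, hQ₀, hs₀, hQs⟩ := exists_generalized_trig (-k)
  obtain ⟨E, hE⟩ : ∃ E : ℝ → ℝ, E = fun x => d * (1 + m2 * P (x - p₀ 1)) + d' * S (x - p₀ 1) :=
    ⟨_, rfl⟩
  obtain ⟨E', hE'⟩ : ∃ E' : ℝ → ℝ,
    E' = fun x => m2 * d * S (x - p₀ 1) + d' * (1 + m2 * P (x - p₀ 1)) := ⟨_, rfl⟩
  have dP : ∀ x, HasDerivAt (fun x => P (x - p₀ 1)) (S (x - p₀ 1)) x := fun x =>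
    (hP _).comp_sub_const x _
  have dS : ∀ x, HasDerivAt (fun x => S (x - p₀ 1)) (1 + m2 * P (x - p₀ 1)) x := fun x =>
    (hS _).comp_sub_const x _
  have dQ : ∀ x, HasDerivAt (fun x => Q (x - p₀ 2)) (s (x - p₀ 2)) x := fun x =>
    (hQ _).comp_sub_const x _
  have ds : ∀ x, HasDerivAt (fun x => s (x - p₀ 2)) (1 + -k * Q (x - p₀ 2)) x := fun x =>
    (hs _).comp_sub_const x _
  have dE : ∀ x, HasDerivAt E (E' x) x := by
    intro x
    rw [hE, hE']
    refine HasDerivAt.congr_deriv (((((dP x).const_mul m2).const_add 1).const_mul d).add ((dS x).const_mul d')) ?_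
    ring
  have dE' : ∀ x, HasDerivAt E' (m2 * E x) x := by
    intro x
    rw [hE, hE']
    refine HasDerivAt.congr_deriv (((dS x).const_mul (m2 * d)).add ((((dP x).const_mul m2).const_add 1).const_mul d')) ?_
    ring
  have hDE : ∀ x ∈ I, D x = E x := fun x hx =>
    eq_of_deriv_deriv_eq_mul hI hIc hD hD' (fun y _ => dE y) (fun y _ => dE' y) hp₀
      (by simp [hE, hd, hP₀, hS₀]) (by simp [hE', hd', hP₀, hS₀]) hx
  have cE : ContDiff ℝ ∞ E := by rw [hE]; fun_prop
  have e₁ : ∀ p : Coord, HasFDerivAt (fun p : Coord => S (p 1 - p₀ 1) - d' * E (p 1) * Q (p 2 - p₀ 2))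
      (coordSMul 1 (1 + m2 * P (p 1 - p₀ 1) - d' * E' (p 1) * Q (p 2 - p₀ 2)) +
        coordSMul 2 (-(d' * E (p 1) * s (p 2 - p₀ 2)))) p := by
    intro p
    have h := (hasFDerivAt_comp_coord 1 (dS (p 1))).sub
      (((hasFDerivAt_comp_coord 1 (dE (p 1))).const_mul d').mul
        (hasFDerivAt_comp_coord 2 (dQ (p 2))))
    refine h.congr_fderiv ?_
    ext v
    simp
    ring
  have e₂ : ∀ p : Coord, HasFDerivAt (fun p : Coord => E (p 1) * s (p 2 - p₀ 2))
      (coordSMul 1 (E' (p 1) * s (p 2 - p₀ 2)) +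
        coordSMul 2 (E (p 1) * (1 + -k * Q (p 2 - p₀ 2)))) p := by
    intro p
    have h := (hasFDerivAt_comp_coord 1 (dE (p 1))).mul (hasFDerivAt_comp_coord 2 (ds (p 2)))
    refine h.congr_fderiv ?_
    ext v
    simp
    ring
  -- On the line y = y₀ this is the unit-speed geodesic (C, S, 0) through the pole. The flow in y
  -- carries it to the other points.
  refine ⟨fun p => 1 + m2 * P (p 1 - p₀ 1) + m2 * d * E (p 1) * Q (p 2 - p₀ 2),
    fun p => S (p 1 - p₀ 1) - d' * E (p 1) * Q (p 2 - p₀ 2), fun p => E (p 1) * s (p 2 - p₀ 2),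
    by fun_prop, by fun_prop, by fun_prop, by simp [hP₀, hQ₀], by simp [hS₀, hQ₀], by simp [hs₀],
    fun p => ?_, fun p => ?_, fun p => ?_, fun p hp u v => ?_, fun p hp u => ?_⟩
  · have r₁ := hPS (p 1 - p₀ 1)
    have r₂ := hQs (p 2 - p₀ 2)
    simp only [hE]
    generalize P (p 1 - p₀ 1) = P at *
    generalize S (p 1 - p₀ 1) = S at *
    generalize Q (p 2 - p₀ 2) = Q at *
    generalize s (p 2 - p₀ 2) = s at *
    subst hk
    clear * - r₁ r₂
    linear_combination (-m2) * r₁ - m2 * (d * (1 + m2 * P) + d' * S) ^ 2 * r₂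
  · rw [(e₁ p).fderiv]
    simp
  · rw [(e₂ p).fderiv]
    simp
  · rw [(e₁ p).fderiv, (e₂ p).fderiv, hDE _ hp]
    simp only [FunLike.coe_add, Pi.add_apply, coordSMul_apply, smul_eq_mul, hE, hE']
    have r₁ := hPS (p 1 - p₀ 1)
    have r₂ := hQs (p 2 - p₀ 2)
    generalize P (p 1 - p₀ 1) = P at *
    generalize S (p 1 - p₀ 1) = S at *
    generalize Q (p 2 - p₀ 2) = Q at *
    generalize s (p 2 - p₀ 2) = s at *
    subst hk
    clear * - r₁ r₂
    linear_combination (d' * (d * (1 + m2 * P) + d' * S) * (m2 * d * S + d' * (1 + m2 * P)) *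
      (u 1 * v 2 - u 2 * v 1)) * r₂
  · rw [(e₁ p).fderiv, (e₂ p).fderiv, hDE _ hp]
    simp only [FunLike.coe_add, Pi.add_apply, coordSMul_apply, smul_eq_mul, hE, hE']
    have r₁ := hPS (p 1 - p₀ 1)
    have r₂ := hQs (p 2 - p₀ 2)
    generalize P (p 1 - p₀ 1) = P at *
    generalize S (p 1 - p₀ 1) = S at *
    generalize Q (p 2 - p₀ 2) = Q at *
    generalize s (p 2 - p₀ 2) = s at *
    have rC : (1 + m2 * P) ^ 2 = 1 + m2 * S ^ 2 := by linear_combination (-m2) * r₁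
    generalize 1 + m2 * P = C at *
    obtain ⟨e, he⟩ : ∃ e, e = d * C + d' * S := ⟨_, rfl⟩
    obtain ⟨e', he'⟩ : ∃ e', e' = m2 * d * S + d' * C := ⟨_, rfl⟩
    rw [← he, ← he']
    -- From here on, f₁ df₂ - f₂ df₁ is put in closed form, and `h₁₁`, `h₁₂`, `h₂₂` compare the
    -- coefficients of the quadratic form in `u 1`, `u 2`.
    have hZ : (S - d' * e * Q) * (e' * s) - e * s * (C - d' * e' * Q) = -(s * d) := by
      rw [he, he']
      linear_combination (-s * d) * rC
    have hY : (S - d' * e * Q) * (e * (1 + -k * Q)) + e * s * (d' * e * s) =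
        e * (S * (1 + -k * Q) + d' * e * Q) := by
      linear_combination (e ^ 2 * d') * r₂
    have h₁₁ : (C - d' * e' * Q) ^ 2 + (e' * s) ^ 2 + m2 * (s * d) ^ 2 =
        (C + m2 * d * e * Q) ^ 2 := by
      rw [he, he', hk] at *
      linear_combination ((m2 * d * S + d' * C) ^ 2 + m2 * d ^ 2) * r₂ +
        (-2 * m2 * d ^ 2 * Q + m2 * d ^ 2 * (d' ^ 2 - m2 * d ^ 2) * Q ^ 2) * rC
    have h₁₂ : (C - d' * e' * Q) * (d' * e * s) - (e' * s) * (e * (1 + -k * Q)) +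
        m2 * (s * d) * (e * (S * (1 + -k * Q) + d' * e * Q)) = 0 := by
      rw [he, he', hk]
      ring
    have h₂₂ : (d' * e * s) ^ 2 + (e * (1 + -k * Q)) ^ 2 +
        m2 * (e * (S * (1 + -k * Q) + d' * e * Q)) ^ 2 = (C + m2 * d * e * Q) ^ 2 * e ^ 2 := by
      rw [he, hk] at *
      linear_combination (d * C + d' * S) ^ 2 * (d' ^ 2 * r₂ + (-1 - 2 * m2 * d ^ 2 * Q +
        (d' ^ 2 - m2 * d ^ 2) * m2 * d ^ 2 * Q ^ 2) * rC)
    have hZY : (S - d' * e * Q) * (u 1 * (e' * s) + u 2 * (e * (1 + -k * Q))) -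
        e * s * (u 1 * (C - d' * e' * Q) + u 2 * -(d' * e * s)) =
        -(s * d) * u 1 + e * (S * (1 + -k * Q) + d' * e * Q) * u 2 := by
      linear_combination u 1 * hZ + u 2 * hY
    rw [hZY]
    linear_combination u 1 ^ 2 * h₁₁ - 2 * u 1 * u 2 * h₁₂ + u 2 ^ 2 * h₂₂

/-! ### The time shift and the construction of the model charts -/

/-- A smooth closed one-form on an open convex set has a smooth primitive. -/
lemma exists_smooth_primitive {V : Set Coord} (hV : IsOpen V) (hVc : Convex ℝ V)
    {A : Coord → Coord →L[ℝ] ℝ} (hA : ContDiffOn ℝ ∞ A V)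
    (hs : ∀ p ∈ V, ∀ u v, fderiv ℝ A p u v = fderiv ℝ A p v u) :
    ∃ h : Coord → ℝ, ContDiffOn ℝ ∞ h V ∧ ∀ p ∈ V, HasFDerivAt h (A p) p := by
  obtain ⟨h, hh⟩ := hVc.exists_forall_hasFDerivWithinAt_of_hasFDerivWithinAt_symmetric
    (dω := fderiv ℝ A)
    (fun p hp => ((hA.contDiffAt (hV.mem_nhds hp)).differentiableAt
      (by simp)).hasFDerivAt.hasFDerivWithinAt)
    (fun p hp u _ v _ => hs p hp u v)
  have hh' : ∀ p ∈ V, HasFDerivAt h (A p) p := fun p hp =>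
    (hh p hp).hasFDerivAt (hV.mem_nhds hp)
  refine ⟨h, ?_, hh'⟩
  rw [contDiffOn_infty_iff_fderiv_of_isOpen hV]
  exact ⟨fun p hp => (hh' p hp).differentiableAt.differentiableWithinAt,
    hA.congr fun p hp => (hh' p hp).fderiv⟩

/-- The time shift one-form `H dy - 2 w (f₁ df₂ - f₂ df₁) / (1 + f₀)`. -/
noncomputable def shiftForm (H : ℝ → ℝ) (w : ℝ) (f₀ f₁ f₂ : Coord → ℝ) (p : Coord) :
    Coord →L[ℝ] ℝ :=
  H (p 1) • coordSMul 2 (1 : ℝ) -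
    (2 * w * (1 + f₀ p)⁻¹) • (f₁ p • fderiv ℝ f₂ p - f₂ p • fderiv ℝ f₁ p)

/-- Let σ = D dx ∧ dy and N = f₁ df₂ - f₂ df₁. Then df₁ ∧ df₂ = f₀ σ and df₀ ∧ N = (f₀² - 1) σ, so
d(N / (1 + f₀)) = σ. As dH ∧ dy = 2wσ, the shift form is closed. -/
lemma fderiv_shiftForm_symm {H D : ℝ → ℝ} {w m2 : ℝ} {f₀ f₁ f₂ : Coord → ℝ}
    (c₀ : ContDiff ℝ ∞ f₀) (c₁ : ContDiff ℝ ∞ f₁) (c₂ : ContDiff ℝ ∞ f₂)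
    (hf : ∀ p, f₀ p ^ 2 = 1 + m2 * (f₁ p ^ 2 + f₂ p ^ 2)) {p : Coord} (h₀ : 0 < f₀ p)
    (hH : HasDerivAt H (2 * w * D (p 1)) (p 1))
    (hdet : ∀ u v, fderiv ℝ f₁ p u * fderiv ℝ f₂ p v - fderiv ℝ f₂ p u * fderiv ℝ f₁ p v =
        f₀ p * D (p 1) * (u 1 * v 2 - u 2 * v 1)) (u v : Coord) :
    fderiv ℝ (shiftForm H w f₀ f₁ f₂) p u v = fderiv ℝ (shiftForm H w f₀ f₁ f₂) p v u := by
  have d₀ : HasFDerivAt f₀ (fderiv ℝ f₀ p) p := (c₀.differentiable (by simp) p).hasFDerivAt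
  have d₁ : HasFDerivAt f₁ (fderiv ℝ f₁ p) p := (c₁.differentiable (by simp) p).hasFDerivAt
  have d₂ : HasFDerivAt f₂ (fderiv ℝ f₂ p) p := (c₂.differentiable (by simp) p).hasFDerivAt
  have dd : ∀ f : Coord → ℝ, ContDiff ℝ ∞ f →
      HasFDerivAt (fderiv ℝ f) (fderiv ℝ (fderiv ℝ f) p) p := fun f hf =>
    ((hf.fderiv_right (m := 1) (WithTop.coe_le_coe.2 le_top)).differentiable (by simp)
      p).hasFDerivAt
  have hsymm : ∀ f : Coord → ℝ, ContDiff ℝ ∞ f →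
      fderiv ℝ (fderiv ℝ f) p v u = fderiv ℝ (fderiv ℝ f) p u v := fun f hf =>
    hf.contDiffAt.isSymmSndFDerivAt (by simp; exact ENat.LEInfty.out) v u
  have hpos : (1 + f₀ p) ≠ 0 := by positivity
  have dc : HasFDerivAt (fun p => 2 * w * (1 + f₀ p)⁻¹)
      ((-(2 * w) * (1 + f₀ p)⁻¹ ^ 2) • fderiv ℝ f₀ p) p := by
    have := ((hasDerivAt_inv hpos).const_mul (2 * w)).comp_hasFDerivAt p (d₀.const_add 1)
    refine this.congr_fderiv ?_
    congr 1
    field_simp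
  have dA : HasFDerivAt (shiftForm H w f₀ f₁ f₂) _ p :=
    (hasFDerivAt_comp_coord 1 ((hH.smul_const (coordSMul 2 (1 : ℝ) : Coord →L[ℝ] ℝ)))).sub
      (dc.smul ((d₁.smul (dd f₂ c₂)).sub (d₂.smul (dd f₁ c₁))))
  have hd₀ : ∀ u, f₀ p * fderiv ℝ f₀ p u =
      m2 * (f₁ p * fderiv ℝ f₁ p u + f₂ p * fderiv ℝ f₂ p u) := by
    intro u
    have e := (d₀.pow 2).unique ((((d₁.pow 2).add (d₂.pow 2)).const_mul m2 |>.const_add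
      1).congr_of_eventuallyEq (Eventually.of_forall hf))
    have e' := DFunLike.congr_fun e u
    simp at e'
    linarith
  have hN : (f₁ p * fderiv ℝ f₂ p v - f₂ p * fderiv ℝ f₁ p v) * fderiv ℝ f₀ p u -
      (f₁ p * fderiv ℝ f₂ p u - f₂ p * fderiv ℝ f₁ p u) * fderiv ℝ f₀ p v =
      (f₀ p ^ 2 - 1) * (D (p 1) * (u 1 * v 2 - u 2 * v 1)) := by
    refine mul_left_cancel₀ h₀.ne' ?_
    linear_combination (f₁ p * fderiv ℝ f₂ p v - f₂ p * fderiv ℝ f₁ p v) * hd₀ u -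
      (f₁ p * fderiv ℝ f₂ p u - f₂ p * fderiv ℝ f₁ p u) * hd₀ v +
      m2 * (f₁ p ^ 2 + f₂ p ^ 2) * hdet u v -
      f₀ p * D (p 1) * (u 1 * v 2 - u 2 * v 1) * hf p
  have hi : (1 + f₀ p)⁻¹ * (1 + f₀ p) = 1 := inv_mul_cancel₀ hpos
  rw [dA.fderiv]
  simp [hsymm f₁ c₁, hsymm f₂ c₂, -inv_pow]
  generalize (1 + f₀ p)⁻¹ = i at *
  linear_combination 2 * w * D (p 1) * (u 1 * v 2 - u 2 * v 1) * ((f₀ p - 1) * i - 1) * hi -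
    4 * w * i * hdet u v + 2 * w * i ^ 2 * hN

namespace RiemannCartan

variable {U : Set Coord} {M : RiemannCartan U} {H D : ℝ → ℝ}

/-- All charts reach the same model at the same point 0, and the model depends only on `m2` and `w`.
This is what makes any two points comparable. -/
lemma exists_isModelChart (hU : IsOpen U) (hg : M.HasGodelMetric H D) {m2 w : ℝ} {I : Set ℝ}
    (hI : IsOpen I) (hIc : IsPreconnected I) (hUI : ∀ p ∈ U, p 1 ∈ I)
    (hH : ContDiffOn ℝ ∞ H I) (hD : DifferentiableOn ℝ D I) (hD2 : DifferentiableOn ℝ (deriv D) I)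
    (hD0 : ∀ x ∈ I, D x ≠ 0) (hH' : ∀ x ∈ I, deriv H x = 2 * w * D x)
    (hD' : ∀ x ∈ I, deriv (deriv D) x = m2 * D x) {p₀ : Coord} (hp₀ : p₀ ∈ U) :
    ∃ Ψ : OpenPartialHomeomorph Coord Coord, M.IsModelChart D m2 w Ψ ∧ p₀ ∈ Ψ.source ∧
      Ψ p₀ = 0 := by
  obtain ⟨f₀, f₁, f₂, c₀, c₁, c₂, h₀, h₁, h₂, hf, ht₁, ht₂, hdet, hmet⟩ :=
    exists_hyperboloid_coords m2 hI hIc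
      (fun x hx => (hD.differentiableAt (hI.mem_nhds hx)).hasDerivAt)
      (fun x hx => by
        rw [← hD' x hx]
        exact (hD2.differentiableAt (hI.mem_nhds hx)).hasDerivAt) (hUI p₀ hp₀)
  -- A ball is convex, as the primitive requires. Positivity of f₀ keeps 1 + f₀ away from zero and
  -- selects the sheet on which f₀ is the square root in `modelRho`.
  obtain ⟨r, hr, hball⟩ : ∃ r > 0, Metric.ball p₀ r ⊆ U ∩ {p | 0 < f₀ p} := by
    refine Metric.isOpen_iff.1 (hU.inter (isOpen_lt continuous_const c₀.continuous)) p₀ ⟨hp₀, ?_⟩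
    change 0 < f₀ p₀
    rw [h₀]
    exact one_pos
  set V := Metric.ball p₀ r
  have hV : IsOpen V := Metric.isOpen_ball
  have hVU : ∀ p ∈ V, p ∈ U := fun p hp => (hball hp).1
  have hV₀ : ∀ p ∈ V, 0 < f₀ p := fun p hp => (hball hp).2
  have hpV : p₀ ∈ V := Metric.mem_ball_self hr
  have cH : ContDiffOn ℝ ∞ (fun p : Coord => H (p 1)) V :=
    hH.comp (by fun_prop) fun p hp => hUI p (hVU p hp)
  have cA : ContDiffOn ℝ ∞ (shiftForm H w f₀ f₁ f₂) V := by
    have k₁ : ContDiffOn ℝ ∞ (fun p => (2 * w * (1 + f₀ p)⁻¹)) V :=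
      contDiffOn_const.mul ((contDiffOn_const.add c₀.contDiffOn).inv fun p hp => by
        have := hV₀ p hp
        positivity)
    have k₂ : ContDiffOn ℝ ∞ (fun p => f₁ p • fderiv ℝ f₂ p - f₂ p • fderiv ℝ f₁ p) V :=
      ((c₁.smul (c₂.fderiv_right (m := ∞) le_rfl)).sub
        (c₂.smul (c₁.fderiv_right (m := ∞) le_rfl))).contDiffOn
    exact (cH.smul contDiffOn_const).sub (k₁.smul k₂)
  obtain ⟨h, ch, hh⟩ := exists_smooth_primitive hV (convex_ball p₀ r) cA fun p hp u v =>
    fderiv_shiftForm_symm c₀ c₁ c₂ hf (hV₀ p hp) (by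
      rw [← hH' _ (hUI p (hVU p hp))]
      exact ((hH.contDiffAt (hI.mem_nhds (hUI p (hVU p hp)))).differentiableAt
        (by simp)).hasDerivAt)
      (hdet p (hUI p (hVU p hp))) u v
  -- Adding the primitive of the shift form to t turns dt + H dy into the one-form of the model,
  -- without changing ∂ₜ.
  let F : Coord → Coord := fun p => ![p 0 - p₀ 0 + (h p - h p₀), f₁ p, f₂ p, p 3 - p₀ 3]
  have cF : ContDiffOn ℝ ∞ F V := by
    rw [contDiffOn_pi]
    intro i
    fin_cases i
    · have k : ContDiffOn ℝ ∞ (fun p : Coord => p 0 - p₀ 0) V := by fun_prop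
      exact k.add (ch.sub contDiffOn_const)
    · exact c₁.contDiffOn
    · exact c₂.contDiffOn
    · have k : ContDiffOn ℝ ∞ (fun p : Coord => p 3 - p₀ 3) V := by fun_prop
      exact k
  have dF : ∀ p ∈ V, ∀ u, fderiv ℝ F p u = ![u 0 + shiftForm H w f₀ f₁ f₂ p u,
      fderiv ℝ f₁ p u, fderiv ℝ f₂ p u, u 3] := by
    intro p hp u
    have d : DifferentiableAt ℝ F p := (cF.contDiffAt (hV.mem_nhds hp)).differentiableAt (by simp)
    have di : ∀ i, HasFDerivAt (fun p => F p i) ((ContinuousLinearMap.proj i).comp (fderiv ℝ F p)) p :=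
      hasFDerivAt_pi'.1 d.hasFDerivAt
    have hc : ∀ i : Fin 4, HasFDerivAt (fun p : Coord => p i - p₀ i) (coordSMul i (1 : ℝ)) p :=
      fun i => hasFDerivAt_comp_coord i ((hasDerivAt_id _).sub_const _)
    have k₀ := DFunLike.congr_fun ((di 0).unique ((hc 0).add ((hh p hp).sub_const (h p₀)))) u
    have k₁ := DFunLike.congr_fun ((di 1).unique (c₁.differentiable (by simp) p).hasFDerivAt) u
    have k₂ := DFunLike.congr_fun ((di 2).unique (c₂.differentiable (by simp) p).hasFDerivAt) u
    have k₃ := DFunLike.congr_fun ((di 3).unique (hc 3)) u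
    ext i
    fin_cases i
    · simpa using k₀
    · exact k₁
    · exact k₂
    · simpa using k₃
  have hA : ∀ p u, shiftForm H w f₀ f₁ f₂ p u = H (p 1) * u 2 -
      2 * w * (f₁ p * fderiv ℝ f₂ p u - f₂ p * fderiv ℝ f₁ p u) / (1 + f₀ p) := by
    intro p u
    simp [shiftForm]
    ring
  have hρ : ∀ p ∈ V, modelRho m2 (F p) = f₀ p := by
    intro p hp
    change √(1 + m2 * (f₁ p ^ 2 + f₂ p ^ 2)) = f₀ p
    rw [← hf, Real.sqrt_sq (hV₀ p hp).le]
  have hinj : ∀ p ∈ V, Function.Injective (fderiv ℝ F p) := by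
    intro p hp
    rw [injective_iff_map_eq_zero]
    intro u hu
    rw [dF p hp] at hu
    have u₀ := congr_fun hu 0
    have u₁ := congr_fun hu 1
    have u₂ := congr_fun hu 2
    have u₃ := congr_fun hu 3
    simp at u₀ u₁ u₂ u₃
    have hne : f₀ p * D (p 1) ≠ 0 :=
      mul_ne_zero (hV₀ p hp).ne' (hD0 _ (hUI p (hVU p hp)))
    -- Pairing `u` with ∂_y and ∂_x under the nonvanishing area form shows that `u 1` and `u 2`
    -- vanish.
    have v₁ := hdet p (hUI p (hVU p hp)) u (Pi.single 2 1)
    have v₂ := hdet p (hUI p (hVU p hp)) u (Pi.single 1 1)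
    rw [u₁, u₂, zero_mul, zero_mul, sub_zero, eq_comm] at v₁ v₂
    have w₁ : u 1 = 0 := by simpa using (mul_eq_zero.1 v₁).resolve_left hne
    have w₂ : u 2 = 0 := by simpa using (mul_eq_zero.1 v₂).resolve_left hne
    rw [hA, u₁, u₂, w₂] at u₀
    ext i
    fin_cases i
    · simpa using u₀
    · exact w₁
    · exact w₂
    · exact u₃
  obtain ⟨Ψ, hΨ, hpΨ, hsub, hsymm⟩ := exists_chart_of_injective_fderiv hV cF hinj hpV
  refine ⟨Ψ, ⟨fun p hp => hVU p (hsub hp), ?_, hsymm, ?_, ?_, ?_, ?_⟩, hpΨ, ?_⟩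
  · rw [hΨ]
    exact cF.mono hsub
  · rw [hΨ]
    exact fun p hp => hinj p (hsub hp)
  · intro p hp u
    have hpV := hsub hp
    rw [hΨ, modelForm, hρ p hpV, dF p hpV, hg p (hVU p hpV)]
    have hm := hmet p (hUI p (hVU p hpV)) u
    have hne : f₀ p ≠ 0 := (hV₀ p hpV).ne'
    -- The metric induced on the quadric in the coordinates (f₁, f₂) follows from `hm` by Lagrange's
    -- identity for (f₁, f₂) and (df₁, df₂).
    have hm' : fderiv ℝ f₁ p u ^ 2 + fderiv ℝ f₂ p u ^ 2 -
        m2 * (f₁ p * fderiv ℝ f₁ p u + f₂ p * fderiv ℝ f₂ p u) ^ 2 / f₀ p ^ 2 =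
        u 1 ^ 2 + D (p 1) ^ 2 * u 2 ^ 2 := by
      field_simp
      linear_combination hm + (fderiv ℝ f₁ p u ^ 2 + fderiv ℝ f₂ p u ^ 2) * hf p
    simp [F]
    rw [hA, hm']
    ring
  · intro p hp u v
    have hpV := hsub hp
    have hne : f₀ p ≠ 0 := (hV₀ p hpV).ne'
    rw [hΨ, modelArea, hρ p hpV, dF p hpV, dF p hpV, div_eq_iff hne]
    have := hdet p (hUI p (hVU p hpV)) u v
    simp
    linear_combination this
  · intro p hp
    rw [hΨ, dF p (hsub hp), hA, ht₁, ht₂]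
    ext i
    fin_cases i <;> simp
  · rw [hΨ]
    ext i
    fin_cases i <;> simp [F, h₁, h₂]

/-- Gödel type Riemann-Cartan structures with constant parameters are locally homogeneous. -/
theorem locallyHomogeneous_of_constants (hU : IsOpen U) (hUc : IsConnected U)
    (hH : ContDiffOn ℝ ∞ H ((fun p : Coord => p 1) '' U))
    (hD : ContDiffOn ℝ ∞ D ((fun p : Coord => p 1) '' U))
    (hD0 : ∀ x ∈ (fun p : Coord => p 1) '' U, D x ≠ 0)
    (hg : M.HasGodelMetric H D) {s : ℝ} (hT : M.HasPolarizedTorsion D fun _ => s) {w m2 : ℝ}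
    (hw : ∀ x ∈ (fun p : Coord => p 1) '' U, deriv H x / D x = 2 * w)
    (hm : ∀ x ∈ (fun p : Coord => p 1) '' U, deriv (deriv D) x / D x = m2) :
    M.LocallyHomogeneous := by
  have hI := isOpen_image_coord hU 1
  have hIc : IsPreconnected ((fun p : Coord => p 1) '' U) :=
    hUc.isPreconnected.image _ (by fun_prop)
  have cD' : ContDiffOn ℝ ∞ (deriv D) ((fun p : Coord => p 1) '' U) :=
    hD.deriv_of_isOpen hI le_rfl
  have key : ∀ p ∈ U, ∃ Ψ : OpenPartialHomeomorph Coord Coord, M.IsModelChart D m2 w Ψ ∧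
      p ∈ Ψ.source ∧ Ψ p = 0 := fun p hp =>
    exists_isModelChart hU hg hI hIc (fun q hq => ⟨q, hq, rfl⟩) hH (hD.differentiableOn (by simp))
      (cD'.differentiableOn (by simp)) hD0
      (fun x hx => by rw [← hw x hx, div_mul_cancel₀ _ (hD0 x hx)])
      (fun x hx => by rw [← hm x hx, div_mul_cancel₀ _ (hD0 x hx)]) hp
  intro p hp q hq
  obtain ⟨Ψ, hΨ, hpΨ, hΨ₀⟩ := key p hp
  obtain ⟨Φ, hΦ, hqΦ, hΦ₀⟩ := key q hq
  refine ⟨Ψ.trans Φ.symm, hΨ.isLocalAffineIsometry hU hT hΦ, ⟨hpΨ, ?_⟩, ?_⟩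
  · change Ψ p ∈ Φ.target
    rw [hΨ₀, ← hΦ₀]
    exact Φ.map_source hqΦ
  · change Φ.symm (Ψ p) = q
    rw [hΨ₀, ← hΦ₀]
    exact Φ.left_inv hqΦ

end RiemannCartan

theorem theorem1 (U : Set Coord) (hU : IsOpen U) (hUc : IsConnected U)
    (H D S : ℝ → ℝ)
    (hH : ContDiffOn ℝ ∞ H ((fun p : Coord => p 1) '' U))
    (hD : ContDiffOn ℝ ∞ D ((fun p : Coord => p 1) '' U))
    (hS : ContDiffOn ℝ ∞ S ((fun p : Coord => p 3) '' U))
    (hD0 : ∀ x ∈ (fun p : Coord => p 1) '' U, D x ≠ 0)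
    (M : RiemannCartan U) (hg : M.HasGodelMetric H D) (hT : M.HasPolarizedTorsion D S) :
    M.LocallyHomogeneous ↔
      (∃ ω₀ : ℝ, ∀ x ∈ (fun p : Coord => p 1) '' U, deriv H x / D x = 2 * ω₀) ∧
      (∃ m2 : ℝ, ∀ x ∈ (fun p : Coord => p 1) '' U, deriv (deriv D) x / D x = m2) ∧
      (∃ S₀ : ℝ, ∀ z ∈ (fun p : Coord => p 3) '' U, S z = S₀) := by
  constructor
  · exact RiemannCartan.LocallyHomogeneous.constants hU hUc hH hD hS hD0 hg hT
  · rintro ⟨⟨w, hw⟩, ⟨m2, hm⟩, ⟨s, hs⟩⟩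
    refine RiemannCartan.locallyHomogeneous_of_constants hU hUc hH hD hD0 hg (s := s) ?_ hw hm
    intro p hp u v
    rw [hT p hp, hs _ ⟨p, hp, rfl⟩]
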